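/- Let $n\ge 1$ and $a=(a_1,\dots,a_n)$ with all integers $a_i>1$; put $d(a)=a_1\cdots a_n$, $\mu(a)=a_1\cdots a_n-a_2\cdots a_n+a_3\cdots a_n-\dots+(-1)^n$ and $a^\vee=(a_n,\dots,a_1)$. Let $\Gamma_a^0=\{(\lambda_1,\dots,\lambda_n)\in(\mathbb C^*)^n : \lambda_1^{a_1}\lambda_2=\dots=\lambda_{n-1}^{a_{n-1}}\lambda_n=\lambda_n^{a_n}=1\}$, acting diagonally on $\mathbb C^n$, and let $L_a^0=\operatorname{Hom}(\Gamma_a^0,\mathbb C^*)$. Let $\widetilde L_a$ be the abelian group with generators $\overline x_1,\dots,\overline x_n,\overline p,T$ and relations $a_1\overline x_1+\overline x_2=\dots=a_{n-1}\overline x_{n-1}+\overline x_n=a_n\overline x_n=\overline p=2T$; put $\tau=(-1)^n\overline x_1$, and let $\widetilde L_a\to L_a^0$ send $\overline x_i$ to the character $\lambda\mapsto\lambda_i$ and $\overline p,T$ to the trivial character. A graded symplectomorphism of $\mathbb C^n$ (with its standard symplectic form and the holomorphic volume form $\Omega=dx_1\wedge\dots\wedge dx_n$) is a symplectomorphism $\phi$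 together with a lift of $(x,\Lambda)\mapsto(\phi(x),D\phi_x\Lambda)$ to a homeomorphism, commuting with the deck group $\mathbb Z$, of the infinite cyclic Maslov cover $\{(x,\Lambda,t): e^{2\pi i t}=\Omega(\Lambda)^2/|\Omega(\Lambda)|^2\}$ of the bundle of Lagrangian subspaces; here $\Omega(\Lambda)$ is the value of $\Omega$ on any real basis of $\Lambda$. The shift $[k]$ is the lift $(x,\Lambda,t)\mapsto(x,\Lambda,t-k)$ of the identity. Let $\hat\Gamma_a^0$ be the group of graded symplectomorphisms of $\mathbb C^n$ whose underlying symplectomorphism is the action of an element of $\Gamma_a^0$. Then: 1. The sequences $0\to\mathbb Z\to\hat\Gamma_a^0\to\Gamma_a^0\to0$ (first map $k\mapsto[k]$) and $0\to\mathbb Z\to\widetilde L_{a^\vee}\to L_{a^\vee}^0\to0$ (first map $k\mapsto kT$) are exact, and $\widetilde L_{a^\vee}$ is generated by $\tau$ and $T$ subject to the single relation $d(a)\tau=(-1)^n2(d(a)-\mu(a^\vee))T$. 2. $\Gamma_a^0$ has a unique element $\phi_a$ with $\lambda_1=e^{2\pi i/d(a)}$, and $\phi_a$ generates $\Gamma_a^0$.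 There is exactly one graded symplectomorphism $\widetilde\phi_a\in\hat\Gamma_a^0$ which is the value at $t=1$ of a continuous family of graded symplectomorphisms $(G_t)_{t\in\mathbb R}$ with $G_0=\mathrm{id}$ that lifts the flow multiplying $x_j$ by $\exp\bigl(2\pi i t\,(-1)^{j-1}a_1\cdots a_{j-1}/d(a)\bigr)$. It is a lift of $\phi_a$, and $\widetilde\phi_a^{\,d(a)}=[(-1)^n2(d(a)-\mu(a^\vee))]$. 3. There are group isomorphisms $\Gamma_a^0\cong L_{a^\vee}^0$ and $\hat\Gamma_a^0\cong\widetilde L_{a^\vee}$ which, together with the identity of $\mathbb Z$, form an isomorphism of the two extensions in 1, and the second of them sends $\widetilde\phi_a$ to $\tau$. -/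

import Mathlib

open scoped ContDiff

noncomputable section

namespace ChainGrading

/-! ## Invariants of the exponent vector -/

/-- The product `d(a) = a_1 ⋯ a_n`. -/
def dInv {n : ℕ} (a : Fin n → ℕ) : ℕ := ∏ i, a i

/-- The Milnor number
`μ(a) = a_1 ⋯ a_n - a_2 ⋯ a_n + a_3 ⋯ a_n - ⋯ + (-1) ^ n`. -/
def milnor {n : ℕ} (a : Fin n → ℕ) : ℤ :=
  ∑ k ∈ Finset.range (n + 1), (-1) ^ k * ∏ i with k ≤ i.val, (a i : ℤ)

/-- The dual vector `a^∨ = (a_n, …, a_1)`. -/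
def dual {n : ℕ} (a : Fin n → ℕ) : Fin n → ℕ := fun i => a i.rev

/-! ## The symmetry groups of the chain polynomial -/

/-- The entry after the `i`-th one, with `1` after the last entry. -/
def nextEntry {n : ℕ} {M : Type*} [One M] (l : Fin n → M) (i : Fin n) : M :=
  if h : i.val + 1 < n then l ⟨i.val + 1, h⟩ else 1

/-- `Γ_a^0`: the diagonal symmetries of
`x_1^{a_1} x_2 + ⋯ + x_{n-1}^{a_{n-1}} x_n + x_n^{a_n}`, that is the tuples in `(ℂ^*)^n` with
`λ_1^{a_1} λ_2 = ⋯ = λ_{n-1}^{a_{n-1}} λ_n = λ_n^{a_n} = 1`. -/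
def Gam {n : ℕ} (a : Fin n → ℕ) : Subgroup (Fin n → ℂˣ) where
  carrier := {l | ∀ i, l i ^ a i * nextEntry l i = 1}
  one_mem' := by
    intro i
    simp [nextEntry]
  mul_mem' := by
    intro l m hl hm i
    have h1 := hl i
    have h2 := hm i
    have h3 : nextEntry (l * m) i = nextEntry l i * nextEntry m i := by
      unfold nextEntry
      split <;> simp
    rw [h3, Pi.mul_apply, mul_pow, mul_mul_mul_comm, h1, h2, one_mul]
  inv_mem' := by
    intro l hl i
    have h1 := hl i
    have h3 : nextEntry l⁻¹ i = (nextEntry l i)⁻¹ := by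
      unfold nextEntry
      split <;> simp
    rw [h3, Pi.inv_apply, inv_pow, ← mul_inv, h1, inv_one]

/-- `L_a^0 = Hom(Γ_a^0, ℂ^*)`. -/
abbrev LZero {n : ℕ} (a : Fin n → ℕ) : Type := Gam a →* ℂˣ

/-- The character `λ ↦ λ_i` of `Γ_a^0`. -/
def coordChar {n : ℕ} (a : Fin n → ℕ) (i : Fin n) : LZero a :=
  (Pi.evalMonoidHom (fun _ : Fin n => ℂˣ) i).comp (Gam a).subtype

/-! ## The extended grading group -/

/-- The generators `x̄_1, …, x̄_n, p̄, T`. -/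
inductive Gen (n : ℕ) : Type
  | x (i : Fin n) : Gen n
  | p : Gen n
  | T : Gen n

/-- `x̄_{i+1}` as an element of the free abelian group on the generators, with `0` after `x̄_n`. -/
def nextGen {n : ℕ} (i : Fin n) : FreeAbelianGroup (Gen n) :=
  if h : i.val + 1 < n then FreeAbelianGroup.of (Gen.x ⟨i.val + 1, h⟩) else 0

/-- The relators for `a_i x̄_i + x̄_{i+1} = p̄` (`i < n`), `a_n x̄_n = p̄` and `2 T = p̄`. -/
def relators {n : ℕ} (a : Fin n → ℕ) : Set (FreeAbelianGroup (Gen n)) :=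
  Set.range (fun i : Fin n =>
      a i • FreeAbelianGroup.of (Gen.x i) + nextGen i - FreeAbelianGroup.of Gen.p) ∪
    {2 • FreeAbelianGroup.of Gen.T - FreeAbelianGroup.of Gen.p}

/-- `L̃_a`: the abelian group with generators `x̄_1, …, x̄_n, p̄, T` and relations
`a_1 x̄_1 + x̄_2 = ⋯ = a_{n-1} x̄_{n-1} + x̄_n = a_n x̄_n = p̄ = 2 T`. -/
abbrev LTilde {n : ℕ} (a : Fin n → ℕ) : Type :=
  FreeAbelianGroup (Gen n) ⧸ AddSubgroup.closure (relators a)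

/-- The class in `L̃_a` of a generator. -/
def gen {n : ℕ} (a : Fin n → ℕ) (g : Gen n) : LTilde a :=
  QuotientAddGroup.mk (FreeAbelianGroup.of g)

/-- The element `τ = (-1)^n x̄_1` of `L̃_a`. -/
def tau {n : ℕ} [NeZero n] (a : Fin n → ℕ) : LTilde a := ((-1) ^ n : ℤ) • gen a (Gen.x 0)

/-- The map `ℤ → L̃_a`, `k ↦ k T`. -/
def shiftL {n : ℕ} (a : Fin n → ℕ) : ℤ →+ LTilde a := zmultiplesHom _ (gen a Gen.T)

/-- The characters of `Γ_a^0` attached to the generators: `x̄_i` gives `λ ↦ λ_i`, while `p̄` and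
`T` give the trivial character. -/
def genChar {n : ℕ} (a : Fin n → ℕ) : Gen n → Additive (LZero a)
  | Gen.x i => Additive.ofMul (coordChar a i)
  | Gen.p => Additive.ofMul 1
  | Gen.T => Additive.ofMul 1

theorem relators_le_ker {n : ℕ} (a : Fin n → ℕ) :
    AddSubgroup.closure (relators a) ≤ (FreeAbelianGroup.lift (genChar a)).ker := by
  rw [AddSubgroup.closure_le]
  rintro r (⟨i, rfl⟩ | rfl)
  · simp only [SetLike.mem_coe, AddMonoidHom.mem_ker, map_sub, map_add, map_nsmul,
      FreeAbelianGroup.lift_apply_of]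
    apply Additive.toMul.injective
    ext l
    have h := l.2 i
    unfold nextEntry at h
    unfold nextGen
    split_ifs with hi
    · rw [dif_pos hi] at h
      simpa [genChar, coordChar] using congrArg Units.val h
    · rw [dif_neg hi] at h
      simpa [genChar, coordChar] using congrArg Units.val h
  · simp only [SetLike.mem_coe, AddMonoidHom.mem_ker, map_sub, map_nsmul,
      FreeAbelianGroup.lift_apply_of]
    apply Additive.toMul.injective
    ext l
    simp [genChar]

/-- The projection `L̃_a → L_a^0` sending `x̄_i` to the character `λ ↦ λ_i` and `T` to the trivial
character. -/
def projL {n : ℕ} (a : Fin n → ℕ) : LTilde a →+ Additive (LZero a) :=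
  QuotientAddGroup.lift _ (FreeAbelianGroup.lift (genChar a)) (relators_le_ker a)

/-! ## Symplectomorphisms of `ℂ^n` -/

/-- The vector space `ℂ^n`. -/
abbrev V (n : ℕ) : Type := EuclideanSpace ℂ (Fin n)

/-- The standard symplectic form `∑ dx_j ∧ dy_j` on `ℂ^n`, where `z_j = x_j + i y_j`. -/
def omega {n : ℕ} (u v : V n) : ℝ := (inner ℂ u v).im

/-- The group of symplectomorphisms of `ℂ^n`. -/
def Symp (n : ℕ) : Subgroup (Equiv.Perm (V n)) where
  carrier := {f | ContDiff ℝ ∞ f ∧ ContDiff ℝ ∞ f.symm ∧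
    ∀ x u v, omega (fderiv ℝ f x u) (fderiv ℝ f x v) = omega u v}
  one_mem' := by
    refine ⟨contDiff_id, contDiff_id, fun x u v => ?_⟩
    have h : fderiv ℝ (⇑(1 : Equiv.Perm (V n))) x = ContinuousLinearMap.id ℝ (V n) := fderiv_id
    rw [h]
    rfl
  mul_mem' := by
    rintro f g ⟨hf, hf', hfo⟩ ⟨hg, hg', hgo⟩
    refine ⟨hf.comp hg, hg'.comp hf', fun x u v => ?_⟩
    have h : fderiv ℝ (⇑(f * g)) x = (fderiv ℝ f (g x)).comp (fderiv ℝ g x) :=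
      fderiv_comp x (hf.differentiable (by simp) _) (hg.differentiable (by simp) _)
    rw [h]
    simp only [ContinuousLinearMap.comp_apply]
    rw [hfo, hgo]
  inv_mem' := by
    rintro f ⟨hf, hf', hfo⟩
    refine ⟨hf', hf, fun x u v => ?_⟩
    have h : (fderiv ℝ f (f.symm x)).comp (fderiv ℝ f.symm x) = ContinuousLinearMap.id ℝ (V n) := by
      rw [← fderiv_comp x (hf.differentiable (by simp) _) (hf'.differentiable (by simp) _)]
      have : (⇑f ∘ ⇑f.symm) = id := by
        funext y
        simp
      rw [this, fderiv_id]
    have hw : ∀ w, fderiv ℝ f (f.symm x) (fderiv ℝ f.symm x w) = w := fun w =>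
      DFunLike.congr_fun h w
    have := hfo (f.symm x) (fderiv ℝ f.symm x u) (fderiv ℝ f.symm x v)
    rw [hw, hw] at this
    exact this.symm

/-- The diagonal action of `(ℂ^*)^n` on `ℂ^n`. -/
def diagAct (n : ℕ) : (Fin n → ℂˣ) →* Equiv.Perm (V n) where
  toFun l :=
    { toFun := fun z => WithLp.toLp 2 (fun i => (l i : ℂ) * z i)
      invFun := fun z => WithLp.toLp 2 (fun i => ((l i)⁻¹ : ℂˣ) * z i)
      left_inv := by
        intro z
        ext i
        simp
      right_inv := by
        intro z
        ext i
        simp }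
  map_one' := by
    ext z i
    simp
  map_mul' := by
    intro l m
    ext z i
    simp [mul_assoc]

theorem diagAct_injective (n : ℕ) : Function.Injective (diagAct n) := by
  intro l m h
  funext i
  have h1 := congrArg (fun f : Equiv.Perm (V n) => f (WithLp.toLp 2 (fun _ => (1 : ℂ))) i) h
  apply Units.ext
  simpa [diagAct] using h1

/-! ## The Lagrangian Grassmannian and its infinite cyclic Maslov cover -/

/-- The Lagrangian Grassmannian of `ℂ^n`: the real subspaces which equal their own symplectic
orthogonal complement. -/
def LGr (n : ℕ) : Type :=
  {S : Submodule ℝ (V n) // ∀ v, v ∈ S ↔ ∀ u ∈ S, omega u v = 0}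

/-- The usual topology of a Grassmannian: a subspace is identified with the orthogonal projection
onto it. -/
instance (n : ℕ) : TopologicalSpace (LGr n) :=
  TopologicalSpace.induced (fun S => (S.1.starProjection : V n →L[ℝ] V n)) inferInstance

/-- The squared phase of the value of `dz_1 ∧ ⋯ ∧ dz_n` on an `n`-tuple of vectors:
`(dz_1 ∧ ⋯ ∧ dz_n)(ξ_1, …, ξ_n) ^ 2 / |(dz_1 ∧ ⋯ ∧ dz_n)(ξ_1, …, ξ_n)| ^ 2`. -/
def sqPhase {n : ℕ} (xi : Fin n → V n) : ℂ :=
  (Matrix.of fun i j => xi j i).det ^ 2 / (‖(Matrix.of fun i j => xi j i).det‖ : ℂ) ^ 2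

/-- The infinite cyclic Maslov cover of the bundle of Lagrangian Grassmannians of the tangent spaces
of `ℂ^n`, defined by the holomorphic volume form `dz_1 ∧ ⋯ ∧ dz_n`: its points are triples
`(x, S, t)` with `exp (2 π i t)` the squared phase of `S`. (A Lagrangian subspace has dimension
`n`, and the squared phase is the same for all of its real bases.) -/
def Cover (n : ℕ) : Type :=
  {q : (V n × LGr n) × ℝ // ∀ xi : Module.Basis (Fin n) ℝ q.1.2.1,
    Complex.exp (2 * Real.pi * Complex.I * q.2) = sqPhase (fun i => (xi i : V n))}

instance (n : ℕ) : TopologicalSpace (Cover n) :=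
  inferInstanceAs (TopologicalSpace (Subtype _))

/-- The base point in `ℂ^n` of a point of the cover. -/
def Cover.pt {n : ℕ} (q : Cover n) : V n := q.1.1.1

/-- The Lagrangian subspace underlying a point of the cover. -/
def Cover.lag {n : ℕ} (q : Cover n) : Submodule ℝ (V n) := q.1.1.2.1

/-- The shift `[k]` of gradings, as a map of the cover: it lowers the real phase by `k`. -/
def shiftFun {n : ℕ} (k : ℤ) (q : Cover n) : Cover n :=
  ⟨(q.1.1, q.1.2 - k), by
    intro xi
    rw [← q.2 xi]
    have h : (2 * Real.pi * Complex.I * ((q.1.2 - k : ℝ) : ℂ)) =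
        2 * Real.pi * Complex.I * (q.1.2 : ℂ) - k * (2 * Real.pi * Complex.I) := by
      push_cast
      ring
    change Complex.exp (2 * Real.pi * Complex.I * ((q.1.2 - k : ℝ) : ℂ)) = _
    rw [h, Complex.exp_sub, Complex.exp_int_mul_two_pi_mul_I, div_one]⟩

theorem continuous_shiftFun {n : ℕ} (k : ℤ) : Continuous (shiftFun k : Cover n → Cover n) := by
  refine Continuous.subtype_mk ?_ _
  have h : Continuous (fun q : Cover n => q.1) := continuous_subtype_val
  fun_prop

theorem shiftFun_add {n : ℕ} (j k : ℤ) (q : Cover n) :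
    shiftFun (j + k) q = shiftFun j (shiftFun k q) := by
  apply Subtype.ext
  apply Prod.ext
  · rfl
  · simp only [shiftFun]
    push_cast
    ring

theorem shiftFun_zero {n : ℕ} (q : Cover n) : shiftFun 0 q = q := by
  apply Subtype.ext
  apply Prod.ext
  · rfl
  · simp [shiftFun]

/-- The shift `[k]` as a homeomorphism of the cover. -/
def shiftHomeo {n : ℕ} (k : ℤ) : Cover n ≃ₜ Cover n where
  toFun := shiftFun k
  invFun := shiftFun (-k)
  left_inv q := by rw [← shiftFun_add, neg_add_cancel, shiftFun_zero]
  right_inv q := by rw [← shiftFun_add, add_neg_cancel, shiftFun_zero]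
  continuous_toFun := continuous_shiftFun k
  continuous_invFun := continuous_shiftFun (-k)

/-! ## Graded symplectomorphisms -/

/-- The group of graded symplectomorphisms of `ℂ^n`: pairs `(f, F)` of a symplectomorphism `f` and a
homeomorphism `F` of the Maslov cover which commutes with the deck transformations and covers the
map `(x, S) ↦ (f x, D f(x) S)`. -/
def GrSymp (n : ℕ) : Subgroup (Symp n × (Cover n ≃ₜ Cover n)) where
  carrier := {f | (∀ k q, f.2 (shiftFun k q) = shiftFun k (f.2 q)) ∧
    ∀ q, (f.2 q).pt = f.1.1 q.pt ∧
      (f.2 q).lag = q.lag.map (fderiv ℝ f.1.1 q.pt : V n →ₗ[ℝ] V n)}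
  one_mem' := by
    refine ⟨fun k q => rfl, fun q => ⟨rfl, ?_⟩⟩
    have h : fderiv ℝ (⇑(1 : Equiv.Perm (V n))) q.pt = ContinuousLinearMap.id ℝ (V n) := fderiv_id
    change q.lag = q.lag.map (fderiv ℝ (⇑(1 : Equiv.Perm (V n))) q.pt : V n →ₗ[ℝ] V n)
    rw [h]
    exact (Submodule.map_id _).symm
  mul_mem' := by
    rintro ⟨f, F⟩ ⟨g, G⟩ ⟨hF, hf⟩ ⟨hG, hg⟩
    simp only at hF hf hG hg
    refine ⟨fun k q => ?_, fun q => ⟨?_, ?_⟩⟩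
    · change F (G (shiftFun k q)) = shiftFun k (F (G q))
      rw [hG, hF]
    · change (F (G q)).pt = f.1 (g.1 q.pt)
      rw [(hf _).1, (hg _).1]
    · change (F (G q)).lag = q.lag.map (fderiv ℝ (⇑f.1 ∘ ⇑g.1) q.pt : V n →ₗ[ℝ] V n)
      rw [fderiv_comp q.pt (f.2.1.differentiable (by simp) _) (g.2.1.differentiable (by simp) _),
        (hf _).2, (hg _).2, (hg _).1, ← Submodule.map_comp]
      rfl
  inv_mem' := by
    rintro ⟨f, F⟩ ⟨hF, hf⟩
    simp only at hF hf
    have hpt : ∀ q, (F.symm q).pt = f.1.symm q.pt := by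
      intro q
      rw [Equiv.eq_symm_apply, ← (hf _).1, F.apply_symm_apply]
    refine ⟨fun k q => ?_, fun q => ⟨hpt q, ?_⟩⟩
    · change F.symm (shiftFun k q) = shiftFun k (F.symm q)
      rw [F.symm_apply_eq, hF, F.apply_symm_apply]
    · change (F.symm q).lag = q.lag.map (fderiv ℝ f.1.symm q.pt : V n →ₗ[ℝ] V n)
      have h1 : q.lag = (F.symm q).lag.map (fderiv ℝ f.1 (F.symm q).pt : V n →ₗ[ℝ] V n) := by
        rw [← (hf _).2, F.apply_symm_apply]
      have h2 : q.pt = f.1 (F.symm q).pt := by rw [← (hf _).1, F.apply_symm_apply]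
      have h3 : (fderiv ℝ f.1.symm q.pt).comp (fderiv ℝ f.1 (F.symm q).pt) =
          ContinuousLinearMap.id ℝ (V n) := by
        rw [h2, ← fderiv_comp _ (f.2.2.1.differentiable (by simp) _)
          (f.2.1.differentiable (by simp) _)]
        have : (⇑f.1.symm ∘ ⇑f.1) = id := by
          funext y
          simp
        rw [this, fderiv_id]
      have h4 : (fderiv ℝ f.1.symm q.pt : V n →ₗ[ℝ] V n) ∘ₗ
          (fderiv ℝ f.1 (F.symm q).pt : V n →ₗ[ℝ] V n) = LinearMap.id :=
        congrArg (fun A : V n →L[ℝ] V n => (A : V n →ₗ[ℝ] V n)) h3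
      rw [h1, ← Submodule.map_comp, h4, Submodule.map_id]

/-- The symplectomorphism underlying a graded one, as a bijection of `ℂ^n`. -/
def underlying (n : ℕ) : GrSymp n →* Equiv.Perm (V n) :=
  ((Symp n).subtype.comp (MonoidHom.fst _ _)).comp (GrSymp n).subtype

/-- The action of a graded symplectomorphism on the Maslov cover. -/
def onCover (n : ℕ) : GrSymp n →* (Cover n ≃ₜ Cover n) :=
  (MonoidHom.snd _ _).comp (GrSymp n).subtype

/-- The shift `[k]` as a graded symplectomorphism, with underlying map the identity. -/
def shiftGr {n : ℕ} (k : ℤ) : GrSymp n :=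
  ⟨(1, shiftHomeo k), by
    refine ⟨fun j q => ?_, fun q => ⟨rfl, ?_⟩⟩
    · change shiftFun k (shiftFun j q) = shiftFun j (shiftFun k q)
      rw [← shiftFun_add, ← shiftFun_add, add_comm]
    · have h : fderiv ℝ (⇑(1 : Equiv.Perm (V n))) q.pt = ContinuousLinearMap.id ℝ (V n) :=
        fderiv_id
      change q.lag = q.lag.map (fderiv ℝ (⇑(1 : Equiv.Perm (V n))) q.pt : V n →ₗ[ℝ] V n)
      rw [h]
      exact (Submodule.map_id _).symm⟩

/-! ## The group of graded lifts of the diagonal symmetries -/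

/-- `Γ̂_a^0`: the group of graded symplectomorphisms whose underlying symplectomorphism is the action
of an element of `Γ_a^0`. -/
def GamHat {n : ℕ} (a : Fin n → ℕ) : Subgroup (GrSymp n) :=
  ((Gam a).map (diagAct n)).comap (underlying n)

/-- The projection `Γ̂_a^0 → Γ_a^0`: the element whose action is the underlying
symplectomorphism. -/
def projHat {n : ℕ} (a : Fin n → ℕ) : GamHat a →* Gam a :=
  ((Gam a).equivMapOfInjective (diagAct n) (diagAct_injective n)).symm.toMonoidHom.comp
    ((underlying n).subgroupComap ((Gam a).map (diagAct n)))

theorem diagAct_projHat {n : ℕ} (a : Fin n → ℕ) (F : GamHat a) :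
    diagAct n (projHat a F : Fin n → ℂˣ) = underlying n F := by
  have h := ((Gam a).equivMapOfInjective (diagAct n) (diagAct_injective n)).apply_symm_apply
    ((underlying n).subgroupComap ((Gam a).map (diagAct n)) F)
  exact congrArg Subtype.val h

/-- The map `ℤ → Γ̂_a^0`, `k ↦ [k]`. -/
def shiftHat {n : ℕ} (a : Fin n → ℕ) : Multiplicative ℤ →* GamHat a where
  toFun k := ⟨shiftGr k.toAdd, ⟨1, (Gam a).one_mem, by rw [map_one]; rfl⟩⟩
  map_one' := by
    apply Subtype.ext
    apply Subtype.ext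
    apply Prod.ext
    · rfl
    · ext1 q
      exact shiftFun_zero q
  map_mul' := by
    intro j k
    apply Subtype.ext
    apply Subtype.ext
    apply Prod.ext
    · rfl
    · ext1 q
      exact shiftFun_add _ _ q

/-- The diagonal flow
`(x_1, …, x_n) ↦ (e^{2 π i t / d(a)} x_1, …, e^{(-1)^{n-1} 2 π i t / a_n} x_n)`; its `j`-th weight is
`(-1)^{j-1} a_1 ⋯ a_{j-1} / d(a)`. -/
def flow {n : ℕ} (a : Fin n → ℕ) (t : ℝ) : Fin n → ℂˣ := fun j =>
  Units.mk0 (Complex.exp (2 * Real.pi * Complex.I * t *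
    ((-1) ^ j.val * (∏ i with i < j, (a i : ℂ)) / (dInv a : ℂ)))) (Complex.exp_ne_zero _)

/-- A graded symplectomorphism in `Γ̂_a^0` is the graded lift of the time `1` map of the flow if it is
the end point of a continuous family of graded symplectomorphisms which lifts the flow and starts
at the identity. -/
def IsFlowLift {n : ℕ} (a : Fin n → ℕ) (F : GamHat a) : Prop :=
  ∃ G : ℝ → GrSymp n, G 0 = 1 ∧ G 1 = F ∧
    (∀ t, underlying n (G t) = diagAct n (flow a t)) ∧
    Continuous (fun s : ℝ × Cover n => onCover n (G s.1) s.2)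

end ChainGrading

end

open ChainGrading

noncomputable section

namespace ChainGrading

/-! ## Arithmetic of the exponent vector -/

/-! Put d = d(a) and s = (-1)^n 2(d - μ(a^∨)). Both extended groups are ℤ² modulo the cyclic
subgroup generated by (d, -s), with (1, 0) going to φ̃_a, respectively τ, and (0, 1) to [1],
respectively T. Both small groups are cyclic of order d. Once the kernels are known
(`presHat_eq_one_iff`, `tau_add_T_eq_zero_iff`), `exists_mulEquiv_of_ker_eq` gives both
isomorphisms, and all compatibilities can be read off on the generators.

Algebraic side. The relations of L̃ say x̄_{k+1} = 2T - a_k x̄_k, so every x̄_k is an integral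
combination of x̄_1 and T, and the last relation is the only one that survives (`top_relation`,
`closure_relators_le`). The T-coefficient obeys the same recursion as the alternating sum defining μ
(`sum_Ico_prod_eq`); passing to a^∨ turns the surviving relation into dτ = sT.

Geometric side. The rotation z_j ↦ e^{2πiθ_j} z_j has a graded lift `rot θ` raising the phase by
2∑θ_j, and `rot` is additive in θ ∈ ℝ^n. The lifted flow is `rot` along the line of weights, whose
j-th coordinate is an integer divided by d. Hence φ̃_a^d is `rot` of an integer vector, which is a
shift (`rot_int`), and summing the weights gives the exponent s.

The remaining point is that a graded lift of the identity is a shift (`exists_eq_shiftGr`). The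
phase change it causes is continuous, integer valued and invariant under shifts, so it suffices that
the Maslov cover is connected modulo shifts. Every Lagrangian is a unitary image of ℝ^n, and
diagonalizing that unitary matrix joins it to the identity by an explicit path which lifts to the
cover. -/

/-- The exponent vector continued by `1`. -/
def entry {n : ℕ} (a : Fin n → ℕ) (k : ℕ) : ℕ := if h : k < n then a ⟨k, h⟩ else 1

theorem entry_fin {n : ℕ} (a : Fin n → ℕ) (i : Fin n) : entry a i = a i := by
  simp [entry]

theorem prod_fin_filter_eq {n : ℕ} {M : Type*} [CommMonoid M] (f : ℕ → M) (s : Finset ℕ)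
    (hs : ∀ i ∈ s, i < n) : ∏ i : Fin n with i.val ∈ s, f i = ∏ i ∈ s, f i := by
  refine Finset.prod_bij (fun i _ => i.val) (by simp) (fun i _ j _ h => Fin.ext h) ?_ (by simp)
  intro b hb
  exact ⟨⟨b, hs b hb⟩, by simpa using hb, rfl⟩

/-- The signed partial product `(-1) ^ k a_1 ⋯ a_k`. -/
def coef {n : ℕ} (a : Fin n → ℕ) (k : ℕ) : ℤ := ∏ i ∈ Finset.range k, -(entry a i : ℤ)

theorem coef_zero {n : ℕ} (a : Fin n → ℕ) : coef a 0 = 1 := by simp [coef]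

theorem coef_succ {n : ℕ} (a : Fin n → ℕ) (k : ℕ) :
    coef a (k + 1) = -(entry a k : ℤ) * coef a k := by
  rw [coef, Finset.prod_range_succ, mul_comm, coef]

theorem coef_eq {n : ℕ} (a : Fin n → ℕ) (k : ℕ) :
    coef a k = (-1) ^ k * ∏ i ∈ Finset.range k, (entry a i : ℤ) := by
  rw [coef, Finset.prod_neg, Finset.card_range]

theorem dInv_eq {n : ℕ} (a : Fin n → ℕ) : dInv a = ∏ i ∈ Finset.range n, entry a i := by
  rw [dInv, Finset.prod_range]
  simp [entry_fin]

theorem coef_top {n : ℕ} (a : Fin n → ℕ) : coef a n = (-1) ^ n * dInv a := by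
  rw [coef_eq, dInv_eq]
  push_cast
  rfl

theorem coef_fin {n : ℕ} (a : Fin n → ℕ) (j : Fin n) :
    coef a j = (-1) ^ j.val * ∏ i with i < j, (a i : ℤ) := by
  rw [coef_eq, ← prod_fin_filter_eq (n := n) _ _ (fun i hi => (Finset.mem_range.1 hi).trans j.2)]
  simp only [entry_fin, Finset.mem_range, Fin.val_fin_lt]

theorem dInv_dual {n : ℕ} (a : Fin n → ℕ) : dInv (dual a) = dInv a :=
  Equiv.prod_comp Fin.revPerm a

/-- Reversing the vector turns the tail products in μ into the initial products a_1 ⋯ a_j;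
reflecting the summation index k ↦ n - k accounts for the global sign. -/
theorem milnor_dual {n : ℕ} (a : Fin n → ℕ) :
    milnor (dual a) = (-1) ^ n * ∑ j ∈ Finset.range (n + 1), coef a j := by
  rw [milnor, ← Finset.sum_range_reflect, Finset.mul_sum]
  refine Finset.sum_congr rfl fun j hj => ?_
  have hj' : j ≤ n := by simpa [Nat.lt_succ_iff] using hj
  have h1 : n + 1 - 1 - j = n - j := by omega
  have h2 : ((-1 : ℤ)) ^ n = (-1) ^ (n - j) * (-1) ^ j := by rw [← pow_add, Nat.sub_add_cancel hj']
  have h3 : ((-1 : ℤ)) ^ j * (-1) ^ j = 1 := by rw [← mul_pow]; simp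
  have h4 : (∏ i : Fin n with n - j ≤ i.val, (dual a i : ℤ)) =
      ∏ i ∈ Finset.range j, (entry a i : ℤ) := by
    rw [← prod_fin_filter_eq (n := n) _ _ (fun i hi => (Finset.mem_range.1 hi).trans_le hj')]
    refine Finset.prod_equiv Fin.revPerm (fun i => ?_) (fun i _ => ?_)
    · simp [Fin.val_rev]
      omega
    · rw [entry_fin]
      rfl
  rw [h1, h4, coef_eq, h2]
  linear_combination (-((-1) ^ (n - j) * ∏ i ∈ Finset.range j, (entry a i : ℤ))) * h3

/-- The exponent `(-1) ^ n 2 (d(a) - μ(a^∨))`. -/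
def shiftExp {n : ℕ} (a : Fin n → ℕ) : ℤ := (-1) ^ n * (2 * (dInv a - milnor (dual a)))

theorem neg_one_pow_mul_self (n : ℕ) : ((-1 : ℤ)) ^ n * (-1) ^ n = 1 := by
  rw [← mul_pow]
  simp

/-- The form of s met on the geometric side: the term j = n of the sum for μ(a^∨) cancels d(a),
leaving the numerators of the n weights. -/
theorem shiftExp_eq_sum {n : ℕ} (a : Fin n → ℕ) :
    shiftExp a = -2 * ∑ j ∈ Finset.range n, coef a j := by
  have h := coef_top a
  rw [shiftExp, milnor_dual, Finset.sum_range_succ, h]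
  linear_combination (-2 * ((-1) ^ n * (dInv a : ℤ) + ∑ j ∈ Finset.range n, coef a j)) *
    neg_one_pow_mul_self n

/-! ### The recursion for the coefficient of T -/

/-- The integers `e_k` with `x̄_{k + 1} = (-1) ^ k a_1 ⋯ a_k x̄_1 + 2 e_k T`. -/
def affCoef {n : ℕ} (a : Fin n → ℕ) : ℕ → ℤ
  | 0 => 0
  | k + 1 => 1 - entry a k * affCoef a k

/-- Both sides start at 1 and satisfy S_{m+1} = a S_m + (-1)^{m+1}, where a is the entry of index m
counted from 0. -/
theorem sum_Ico_prod_eq {n : ℕ} (a : Fin n → ℕ) (m : ℕ) :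
    ∑ k ∈ Finset.range (m + 1), (-1) ^ k * ∏ i ∈ Finset.Ico k m, (entry a i : ℤ) =
      ∏ i ∈ Finset.range m, (entry a i : ℤ) + (-1) ^ m * affCoef a m := by
  induction m with
  | zero => simp [affCoef]
  | succ m ih =>
    rw [Finset.sum_range_succ, Finset.prod_range_succ, affCoef]
    have h : ∑ k ∈ Finset.range (m + 1), (-1) ^ k * ∏ i ∈ Finset.Ico k (m + 1), (entry a i : ℤ) =
        (∑ k ∈ Finset.range (m + 1), (-1) ^ k * ∏ i ∈ Finset.Ico k m, (entry a i : ℤ)) *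
          entry a m := by
      rw [Finset.sum_mul]
      refine Finset.sum_congr rfl fun k hk => ?_
      rw [Finset.prod_Ico_succ_top (by simpa [Nat.lt_succ_iff] using hk), mul_assoc]
    rw [h, ih, Finset.Ico_self, Finset.prod_empty]
    ring

theorem milnor_eq {n : ℕ} (a : Fin n → ℕ) :
    milnor a = dInv a + (-1) ^ n * affCoef a n := by
  rw [dInv_eq]
  push_cast
  rw [← sum_Ico_prod_eq, milnor]
  refine Finset.sum_congr rfl fun k _ => ?_
  rw [← prod_fin_filter_eq (n := n) _ _ (fun i hi => (Finset.mem_Ico.1 hi).2)]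
  simp [entry_fin]

theorem shiftExp_eq_affCoef {n : ℕ} (a : Fin n → ℕ) :
    shiftExp a = -2 * affCoef (dual a) n := by
  rw [shiftExp, milnor_eq, dInv_dual]
  linear_combination (-2 * affCoef (dual a) n) * neg_one_pow_mul_self n

/-! ## The group of diagonal symmetries is cyclic -/

theorem nextEntry_eq_of_mem {n : ℕ} {a : Fin n → ℕ} {l : Fin n → ℂˣ} (hl : l ∈ Gam a) (i : Fin n) :
    nextEntry l i = (l i ^ a i)⁻¹ :=
  eq_inv_of_mul_eq_one_right (hl i)

/-- Each equation but the last expresses an entry as λ_{k+1} = λ_k^{-a_k}, so λ_1 determines the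
whole tuple and only the last equation constrains it. -/
theorem apply_eq_zpow_coef {n : ℕ} [NeZero n] {a : Fin n → ℕ} {l : Fin n → ℂˣ} (hl : l ∈ Gam a)
    (i : Fin n) : l i = l 0 ^ coef a i := by
  obtain ⟨k, hk⟩ := i
  induction k with
  | zero =>
    have h : (⟨0, hk⟩ : Fin n) = 0 := Fin.ext (by simp)
    rw [h]
    simp [coef_zero]
  | succ k ih =>
    have hk' : k < n := by omega
    have h := nextEntry_eq_of_mem hl ⟨k, hk'⟩
    rw [nextEntry, dif_pos hk, ih hk'] at h
    rw [h, coef_succ, ← entry_fin a ⟨k, hk'⟩, ← zpow_natCast, ← zpow_mul, ← zpow_neg]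
    congr 1
    ring

theorem apply_zero_pow_dInv {n : ℕ} [NeZero n] {a : Fin n → ℕ} {l : Fin n → ℂˣ}
    (hl : l ∈ Gam a) : l 0 ^ dInv a = 1 := by
  obtain ⟨m, rfl⟩ := Nat.exists_eq_succ_of_ne_zero (NeZero.ne n)
  have h := hl (Fin.last m)
  rw [nextEntry, dif_neg (by simp), mul_one, apply_eq_zpow_coef hl] at h
  have h1 : coef a (m + 1) = -(a (Fin.last m) : ℤ) * coef a m := by
    rw [coef_succ, ← entry_fin a (Fin.last m)]
    rfl
  -- The last equation reads λ_1^{±d(a)} = 1; the sign is removed below.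
  have h2 : l 0 ^ coef a (m + 1) = 1 := by
    rw [h1, mul_comm, zpow_mul, zpow_neg, zpow_natCast]
    simpa using h
  rw [coef_top, mul_comm, zpow_mul, zpow_natCast] at h2
  rcases neg_one_pow_eq_or ℤ (m + 1) with h3 | h3 <;> rw [h3] at h2 <;> simpa using h2

theorem Gam_ext {n : ℕ} [NeZero n] {a : Fin n → ℕ} {g h : Gam a}
    (h0 : (g : Fin n → ℂˣ) 0 = (h : Fin n → ℂˣ) 0) : g = h := by
  apply Subtype.ext
  funext i
  rw [apply_eq_zpow_coef g.2, apply_eq_zpow_coef h.2, h0]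

theorem dInv_ne_zero {n : ℕ} {a : Fin n → ℕ} (ha : ∀ i, a i ≠ 0) : dInv a ≠ 0 :=
  Finset.prod_ne_zero_iff.2 fun i _ => ha i

/-- The weight `(-1) ^ j a_1 ⋯ a_j / d(a)` of the diagonal flow. -/
def weight {n : ℕ} (a : Fin n → ℕ) (k : ℕ) : ℝ := coef a k / dInv a

theorem flow_apply {n : ℕ} (a : Fin n → ℕ) (t : ℝ) (j : Fin n) :
    (flow a t j : ℂ) = Complex.exp (2 * Real.pi * Complex.I * ((t * weight a j : ℝ) : ℂ)) := by
  simp only [flow, Units.val_mk0, weight, coef_fin]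
  congr 1
  push_cast
  ring

theorem flow_one_mem {n : ℕ} {a : Fin n → ℕ} (ha : ∀ i, a i ≠ 0) : flow a 1 ∈ Gam a := by
  intro i
  have hd : (dInv a : ℝ) ≠ 0 := Nat.cast_ne_zero.2 (dInv_ne_zero ha)
  -- The weights satisfy the additive form of the defining equations.
  have hw : (a i : ℝ) * weight a i + weight a (i + 1) = 0 := by
    simp only [weight, coef_succ, entry_fin]
    push_cast
    field_simp
    ring
  have hw' : ((a i : ℂ) * (weight a i : ℝ) + (weight a (i + 1) : ℝ)) = 0 := by exact_mod_cast hw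
  have hnext : ((nextEntry (flow a 1) i : ℂˣ) : ℂ) =
      Complex.exp (2 * Real.pi * Complex.I * (weight a (i + 1) : ℝ)) := by
    rw [nextEntry]
    split_ifs with h
    · rw [flow_apply, one_mul]
    -- The weight one past the end is (-1)^n, an integer, which matches the convention that the
    -- entry after the last is 1.
    · have hi : i.val + 1 = n := by omega
      rw [hi, weight, coef_top]
      have : (((((-1) ^ n * dInv a : ℤ) : ℝ) / dInv a : ℝ) : ℂ) = (((-1) ^ n : ℤ) : ℂ) := by
        push_cast
        have hd' : (dInv a : ℂ) ≠ 0 := Nat.cast_ne_zero.2 (dInv_ne_zero ha)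
        exact mul_div_cancel_right₀ _ hd'
      rw [this, mul_comm, Complex.exp_int_mul_two_pi_mul_I]
      simp
  apply Units.ext
  rw [Units.val_mul, Units.val_pow_eq_pow_val, hnext, flow_apply, one_mul, ← Complex.exp_nat_mul,
    ← Complex.exp_add, Units.val_one]
  convert Complex.exp_zero using 2
  linear_combination (2 * Real.pi * Complex.I) * hw'

/-- The generator `φ_a` of `Γ_a^0`, with first entry `e^{2 π i / d(a)}`. -/
def generator {n : ℕ} {a : Fin n → ℕ} (ha : ∀ i, a i ≠ 0) : Gam a := ⟨flow a 1, flow_one_mem ha⟩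

theorem generator_apply_zero {n : ℕ} [NeZero n] {a : Fin n → ℕ} (ha : ∀ i, a i ≠ 0) :
    (((generator ha : Gam a) : Fin n → ℂˣ) 0 : ℂ) =
      Complex.exp (2 * Real.pi * Complex.I / (dInv a : ℂ)) := by
  change (flow a 1 0 : ℂ) = _
  rw [flow_apply]
  simp [weight, coef_zero]
  rfl

theorem isPrimitiveRoot_generator {n : ℕ} [NeZero n] {a : Fin n → ℕ} (ha : ∀ i, a i ≠ 0) :
    IsPrimitiveRoot (((generator ha : Gam a) : Fin n → ℂˣ) 0) (dInv a) := by
  rw [← IsPrimitiveRoot.coe_units_iff, generator_apply_zero]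
  exact Complex.isPrimitiveRoot_exp _ (dInv_ne_zero ha)

theorem exists_zpow_of_pow_eq_one {n : ℕ} [NeZero n] {a : Fin n → ℕ} (ha : ∀ i, a i ≠ 0) {u : ℂˣ}
    (hu : u ^ dInv a = 1) : ∃ i : ℤ, (((generator ha : Gam a) : Fin n → ℂˣ) 0) ^ i = u := by
  have : NeZero (dInv a) := ⟨dInv_ne_zero ha⟩
  have h := (IsPrimitiveRoot.coe_units_iff.2 (isPrimitiveRoot_generator ha))
  obtain ⟨i, -, hi⟩ := h.eq_pow_of_pow_eq_one (ξ := (u : ℂ)) (by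
    rw [← Units.val_pow_eq_pow_val, hu, Units.val_one])
  exact ⟨i, Units.ext (by simpa using hi)⟩

theorem exists_generator_zpow {n : ℕ} [NeZero n] {a : Fin n → ℕ} (ha : ∀ i, a i ≠ 0) (g : Gam a) :
    ∃ i : ℤ, generator ha ^ i = g := by
  obtain ⟨i, hi⟩ := exists_zpow_of_pow_eq_one ha (apply_zero_pow_dInv g.2)
  exact ⟨i, Gam_ext (by simpa using hi)⟩

theorem generator_zpow_eq_one_iff {n : ℕ} [NeZero n] {a : Fin n → ℕ} (ha : ∀ i, a i ≠ 0) (i : ℤ) :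
    generator ha ^ i = 1 ↔ (dInv a : ℤ) ∣ i := by
  rw [← (isPrimitiveRoot_generator ha).zpow_eq_one_iff_dvd]
  refine ⟨fun h => ?_, fun h => Gam_ext (by simpa using h)⟩
  simpa using congrArg (fun g : Gam a => (g : Fin n → ℂˣ) 0) h

/-! ## Characters -/

theorem coordChar_zpow_eq_one_iff {n : ℕ} [NeZero n] {a : Fin n → ℕ} (ha : ∀ i, a i ≠ 0) (i : ℤ) :
    coordChar a 0 ^ i = 1 ↔ (dInv a : ℤ) ∣ i := by
  rw [← (isPrimitiveRoot_generator ha).zpow_eq_one_iff_dvd]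
  constructor
  · intro h
    simpa [coordChar] using DFunLike.congr_fun h (generator ha)
  · intro h
    ext g
    obtain ⟨k, rfl⟩ := exists_generator_zpow ha g
    have h1 : (coordChar a 0 ^ i) (generator ha) = 1 := by simpa [coordChar] using h
    rw [map_zpow, h1]
    simp

/-- A character is determined by its value on the generator. That value is a d(a)-th root of unity,
hence a power of the primitive root λ_1. -/
theorem exists_coordChar_zpow {n : ℕ} [NeZero n] {a : Fin n → ℕ} (ha : ∀ i, a i ≠ 0)
    (c : LZero a) : ∃ i : ℤ, coordChar a 0 ^ i = c := by
  have h : c (generator ha) ^ dInv a = 1 := by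
    rw [← map_pow]
    have := (generator_zpow_eq_one_iff ha (dInv a)).2 dvd_rfl
    rw [zpow_natCast] at this
    rw [this, map_one]
  obtain ⟨i, hi⟩ := exists_zpow_of_pow_eq_one ha h
  refine ⟨i, ?_⟩
  ext g
  obtain ⟨k, rfl⟩ := exists_generator_zpow ha g
  have h1 : (coordChar a 0 ^ i) (generator ha) = c (generator ha) := by simpa [coordChar] using hi
  rw [map_zpow, map_zpow, h1]

/-! ## The extended grading group -/

theorem gen_relation {n : ℕ} (a : Fin n → ℕ) (i : Fin n) :
    a i • gen a (Gen.x i) + QuotientAddGroup.mk (nextGen i) = gen a Gen.p := by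
  rw [← sub_eq_zero]
  exact (QuotientAddGroup.eq_zero_iff _).2 (AddSubgroup.subset_closure (Or.inl ⟨i, rfl⟩))

theorem two_nsmul_gen_T {n : ℕ} (a : Fin n → ℕ) : 2 • gen a Gen.T = gen a Gen.p := by
  rw [← sub_eq_zero]
  exact (QuotientAddGroup.eq_zero_iff _).2 (AddSubgroup.subset_closure (Or.inr rfl))

theorem mk_nextGen {n : ℕ} (a : Fin n → ℕ) (i : Fin n) :
    (QuotientAddGroup.mk (nextGen i) : LTilde a) =
      (2 : ℤ) • gen a Gen.T - (a i : ℤ) • gen a (Gen.x i) := by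
  have h := gen_relation a i
  rw [← two_nsmul_gen_T] at h
  rw [eq_sub_iff_add_eq, add_comm]
  exact_mod_cast h

theorem gen_x_eq {n : ℕ} [NeZero n] (a : Fin n → ℕ) (i : Fin n) :
    gen a (Gen.x i) = coef a i • gen a (Gen.x 0) + (2 * affCoef a i) • gen a Gen.T := by
  obtain ⟨k, hk⟩ := i
  induction k with
  | zero =>
    have h : (⟨0, hk⟩ : Fin n) = 0 := Fin.ext (by simp)
    rw [h]
    simp [coef_zero, affCoef]
  | succ k ih =>
    have hk' : k < n := by omega
    have h := mk_nextGen a ⟨k, hk'⟩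
    rw [nextGen, dif_pos hk, ih hk', ← entry_fin a ⟨k, hk'⟩] at h
    change gen a _ = _ at h
    rw [h, coef_succ, affCoef]
    module

theorem top_relation {n : ℕ} [NeZero n] (a : Fin n → ℕ) :
    coef a n • gen a (Gen.x 0) + (2 * affCoef a n) • gen a Gen.T = 0 := by
  obtain ⟨m, rfl⟩ := Nat.exists_eq_succ_of_ne_zero (NeZero.ne n)
  have h := mk_nextGen a (Fin.last m)
  rw [nextGen, dif_neg (by simp), gen_x_eq, ← entry_fin a (Fin.last m)] at h
  change 0 = _ at h
  have h1 : coef a (m + 1) = -(entry a m : ℤ) * coef a m := coef_succ a m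
  have h2 : affCoef a (m + 1) = 1 - entry a m * affCoef a m := rfl
  simp only [Fin.val_last] at h
  change coef a (m + 1) • gen a (Gen.x 0) + (2 * affCoef a (m + 1)) • gen a Gen.T = 0
  rw [h1, h2, h]
  module

/-- The coordinates of the generators with respect to `x̄_1` and `T`. -/
def genCoord {n : ℕ} (a : Fin n → ℕ) : Gen n → ℤ × ℤ
  | Gen.x i => (coef a i, 2 * affCoef a i)
  | Gen.p => (0, 2)
  | Gen.T => (0, 1)

/-- This shows that there are no further relations. Under the coordinates in ℤ² every relator
vanishes except the one for x̄_n, which becomes minus the vector of `top_relation`. -/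
theorem closure_relators_le {n : ℕ} (a : Fin n → ℕ) :
    AddSubgroup.closure (relators a) ≤
      (AddSubgroup.zmultiples ((coef a n, 2 * affCoef a n) : ℤ × ℤ)).comap
        (FreeAbelianGroup.lift (genCoord a)) := by
  rw [AddSubgroup.closure_le]
  rintro r (⟨i, rfl⟩ | rfl)
  · simp only [SetLike.mem_coe, AddSubgroup.mem_comap, map_sub, map_add, map_nsmul,
      FreeAbelianGroup.lift_apply_of, nextGen]
    have h1 : a i • genCoord a (Gen.x i) - genCoord a Gen.p =
        -(coef a (i + 1), 2 * affCoef a (i + 1)) := by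
      simp only [genCoord, coef_succ, affCoef, entry_fin]
      ext <;> simp
      ring
    rw [add_sub_right_comm, h1]
    split_ifs with h
    · rw [FreeAbelianGroup.lift_apply_of]
      simp only [genCoord, neg_add_cancel]
      exact zero_mem _
    · have hi : i.val + 1 = n := by omega
      rw [map_zero, add_zero, hi]
      exact neg_mem (AddSubgroup.mem_zmultiples _)
  · simp only [SetLike.mem_coe, AddSubgroup.mem_comap, map_sub, map_nsmul,
      FreeAbelianGroup.lift_apply_of]
    have h : 2 • genCoord a Gen.T - genCoord a Gen.p = 0 := by
      ext <;> simp [genCoord]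
    rw [h]
    exact zero_mem _

theorem x_add_T_eq_zero_iff {n : ℕ} [NeZero n] (a : Fin n → ℕ) (i j : ℤ) :
    i • gen a (Gen.x 0) + j • gen a Gen.T = 0 ↔
      ∃ m : ℤ, i = m * coef a n ∧ j = m * (2 * affCoef a n) := by
  constructor
  · intro h
    have h1 : (QuotientAddGroup.mk (i • FreeAbelianGroup.of (Gen.x 0) +
      j • FreeAbelianGroup.of Gen.T) : LTilde a) = 0 := h
    have h2 := closure_relators_le a ((QuotientAddGroup.eq_zero_iff _).1 h1)
    rw [AddSubgroup.mem_comap, AddSubgroup.mem_zmultiples_iff] at h2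
    obtain ⟨m, hm⟩ := h2
    simp only [map_add, map_zsmul, FreeAbelianGroup.lift_apply_of, genCoord] at hm
    have h3 := congrArg Prod.fst hm
    have h4 := congrArg Prod.snd hm
    simp [coef_zero, affCoef] at h3 h4
    exact ⟨m, h3.symm, h4.symm⟩
  · rintro ⟨m, rfl, rfl⟩
    rw [mul_zsmul, mul_zsmul, ← zsmul_add, top_relation, zsmul_zero]

theorem tau_add_T_eq_zero_iff {n : ℕ} [NeZero n] (a : Fin n → ℕ) (i j : ℤ) :
    i • tau (dual a) + j • gen (dual a) Gen.T = 0 ↔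
      ∃ m : ℤ, i = m * dInv a ∧ j = -(m * shiftExp a) := by
  rw [tau, ← mul_zsmul, x_add_T_eq_zero_iff, coef_top, dInv_dual, shiftExp_eq_affCoef]
  refine exists_congr fun m => and_congr ?_ ?_
  -- The sign in τ = (-1)^n x̄_1 cancels the sign of `coef` at n.
  · rcases neg_one_pow_eq_or ℤ n with h | h <;> simp [h]
  · constructor <;> rintro rfl <;> ring

theorem exists_tau_add_T {n : ℕ} [NeZero n] (a : Fin n → ℕ) (l : LTilde a) :
    ∃ i j : ℤ, l = i • tau a + j • gen a Gen.T := by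
  have hx : gen a (Gen.x 0) = ((-1) ^ n : ℤ) • tau a := by
    rw [tau, ← mul_zsmul, neg_one_pow_mul_self, one_zsmul]
  obtain ⟨l, rfl⟩ := QuotientAddGroup.mk_surjective l
  have hgen : ∀ g, ∃ i j : ℤ, gen a g = i • tau a + j • gen a Gen.T := by
    rintro (i | _ | _)
    · rw [gen_x_eq, hx, ← mul_zsmul]
      exact ⟨_, _, rfl⟩
    · exact ⟨0, 2, by rw [← two_nsmul_gen_T]; module⟩
    · exact ⟨0, 1, by module⟩
  induction l using FreeAbelianGroup.induction_on with
  | zero => exact ⟨0, 0, by simp⟩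
  | of g => exact hgen g
  | neg g hg =>
    obtain ⟨i, j, h⟩ := hg
    refine ⟨-i, -j, ?_⟩
    rw [QuotientAddGroup.mk_neg, h]
    module
  | add x y hx hy =>
    obtain ⟨i, j, h⟩ := hx
    obtain ⟨i', j', h'⟩ := hy
    refine ⟨i + i', j + j', ?_⟩
    rw [QuotientAddGroup.mk_add, h, h']
    module

/-! ### The projection to the characters -/

theorem projL_gen {n : ℕ} (a : Fin n → ℕ) (g : Gen n) : projL a (gen a g) = genChar a g := by
  change FreeAbelianGroup.lift (genChar a) (FreeAbelianGroup.of g) = _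
  rw [FreeAbelianGroup.lift_apply_of]

theorem LZero_zpow_mul {n : ℕ} {a : Fin n → ℕ} (c : LZero a) (i j : ℤ) :
    (c ^ i) ^ j = c ^ (i * j) :=
  (zpow_mul c i j).symm

theorem projL_tau_add_T {n : ℕ} [NeZero n] (a : Fin n → ℕ) (i j : ℤ) :
    projL a (i • tau a + j • gen a Gen.T) =
      Additive.ofMul ((coordChar a 0 ^ ((-1) ^ n : ℤ)) ^ i) := by
  rw [map_add, map_zsmul, map_zsmul, tau, map_zsmul, projL_gen, projL_gen]
  have h : j • genChar a Gen.T = 0 :=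
    zsmul_zero (α := Additive (LZero a)) j
  rw [h]
  exact add_zero (M := Additive (LZero a)) _

/-- The character `(λ ↦ λ_1) ^ {(-1) ^ n}`, the image of `τ`. -/
def tauChar {n : ℕ} [NeZero n] (a : Fin n → ℕ) : LZero a := coordChar a 0 ^ ((-1) ^ n : ℤ)

theorem tauChar_zpow_eq_one_iff {n : ℕ} [NeZero n] {a : Fin n → ℕ} (ha : ∀ i, a i ≠ 0) (i : ℤ) :
    tauChar a ^ i = 1 ↔ (dInv a : ℤ) ∣ i := by
  rw [tauChar, LZero_zpow_mul, coordChar_zpow_eq_one_iff ha]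
  rcases neg_one_pow_eq_or ℤ n with h | h <;> simp [h]

theorem exists_tauChar_zpow {n : ℕ} [NeZero n] {a : Fin n → ℕ} (ha : ∀ i, a i ≠ 0)
    (c : LZero a) : ∃ i : ℤ, tauChar a ^ i = c := by
  obtain ⟨i, hi⟩ := exists_coordChar_zpow ha c
  refine ⟨(-1) ^ n * i, ?_⟩
  rw [tauChar, LZero_zpow_mul, ← mul_assoc, neg_one_pow_mul_self, one_mul, hi]

theorem projL_eq_zero_iff {n : ℕ} [NeZero n] {a : Fin n → ℕ} (ha : ∀ i, a i ≠ 0) (i j : ℤ) :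
    projL a (i • tau a + j • gen a Gen.T) = 0 ↔ (dInv a : ℤ) ∣ i := by
  rw [projL_tau_add_T, ← tauChar_zpow_eq_one_iff ha]
  rfl

theorem shiftL_apply {n : ℕ} (a : Fin n → ℕ) (k : ℤ) : shiftL a k = k • gen a Gen.T := rfl

theorem exact_LTilde {n : ℕ} [NeZero n] (a : Fin n → ℕ) (ha : ∀ i, a i ≠ 0) :
    Function.Injective (shiftL (dual a)) ∧ (shiftL (dual a)).range = (projL (dual a)).ker ∧
      Function.Surjective (projL (dual a)) := by
  have hb : ∀ i, dual a i ≠ 0 := fun i => ha _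
  refine ⟨?_, ?_, ?_⟩
  · rw [injective_iff_map_eq_zero]
    intro k hk
    rw [shiftL_apply] at hk
    obtain ⟨m, h1, h2⟩ := (tau_add_T_eq_zero_iff a 0 k).1 (by rw [hk]; simp)
    have hm : m = 0 := by
      have := dInv_ne_zero ha
      simpa [this] using h1.symm
    rw [h2, hm]
    simp
  · ext l
    rw [AddMonoidHom.mem_ker, AddMonoidHom.mem_range]
    constructor
    · rintro ⟨k, rfl⟩
      rw [shiftL_apply, map_zsmul, projL_gen]
      exact zsmul_zero (α := Additive (LZero (dual a))) k
    · intro h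
      obtain ⟨i, j, rfl⟩ := exists_tau_add_T _ l
      rw [projL_eq_zero_iff hb, dInv_dual] at h
      obtain ⟨m, rfl⟩ := h
      -- Here i = d(a) m, and d(a)τ = sT rewrites iτ as a multiple of T.
      refine ⟨m * shiftExp a + j, ?_⟩
      have := (tau_add_T_eq_zero_iff a (dInv a * m) (-(m * shiftExp a))).2 ⟨m, mul_comm _ _, rfl⟩
      rw [shiftL_apply, ← add_zero ((m * shiftExp a + j) • gen (dual a) Gen.T), ← this]
      module
  · intro c
    obtain ⟨i, hi⟩ := exists_tauChar_zpow hb (Additive.toMul c)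
    refine ⟨i • tau _ + (0 : ℤ) • gen _ Gen.T, ?_⟩
    rw [projL_tau_add_T]
    exact congrArg Additive.ofMul hi

/-- Two quotients of a group with the same kernel are isomorphic. -/
theorem exists_mulEquiv_of_ker_eq {X A B : Type*} [Group X] [Group A] [Group B] (f : X →* A)
    (g : X →* B) (hf : Function.Surjective f) (hg : Function.Surjective g)
    (h : ∀ x, f x = 1 ↔ g x = 1) : ∃ e : A ≃* B, ∀ x, e (f x) = g x := by
  have hk : f.ker = g.ker := by
    ext x
    exact h x
  refine ⟨(QuotientGroup.quotientKerEquivOfSurjective f hf).symm.trans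
    ((QuotientGroup.quotientMulEquivOfEq hk).trans
      (QuotientGroup.quotientKerEquivOfSurjective g hg)), fun x => ?_⟩
  have : (QuotientGroup.quotientKerEquivOfSurjective f hf).symm (f x) = QuotientGroup.mk x := by
    rw [MulEquiv.symm_apply_eq]
    rfl
  simp only [MulEquiv.trans_apply, this]
  rfl

/-! ## Lagrangian subspaces -/

theorem inner_real_eq_re {n : ℕ} (u v : V n) : inner ℝ u v = (inner ℂ u v).re := by
  simp [PiLp.inner_apply, Complex.inner]

theorem omega_eq_inner {n : ℕ} (u v : V n) : omega u v = inner ℝ (Complex.I • u) v := by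
  rw [inner_real_eq_re, inner_smul_left, omega]
  simp

/-- Multiplication by `i`, as a real linear automorphism. -/
def mulI (n : ℕ) : V n ≃ₗ[ℝ] V n :=
  (LinearEquiv.smulOfNeZero ℂ (V n) Complex.I Complex.I_ne_zero).restrictScalars ℝ

/-- Since ω(u, v) is the real inner product of iu with v, the symplectic complement of S is the
orthogonal complement of iS. This gives dim S = n by counting dimensions. -/
theorem LGr.eq_orthogonal {n : ℕ} (S : LGr n) :
    S.1 = (S.1.map (mulI n : V n →ₗ[ℝ] V n))ᗮ := by
  ext v
  rw [S.2 v, Submodule.mem_orthogonal]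
  constructor
  · rintro h - ⟨u, hu, rfl⟩
    exact (omega_eq_inner u v).symm.trans (h u hu)
  · intro h u hu
    exact (omega_eq_inner u v).trans (h _ ⟨u, hu, rfl⟩)

theorem finrank_real_V (n : ℕ) : Module.finrank ℝ (V n) = 2 * n := by
  rw [← Module.finrank_mul_finrank ℝ ℂ (V n)]
  simp

theorem LGr.finrank_eq {n : ℕ} (S : LGr n) : Module.finrank ℝ S.1 = n := by
  have h1 := Submodule.finrank_add_finrank_orthogonal (S.1.map (mulI n : V n →ₗ[ℝ] V n))
  rw [← S.eq_orthogonal, LinearEquiv.finrank_map_eq, finrank_real_V] at h1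
  omega

/-- An orthonormal real basis of a Lagrangian subspace. -/
def LGr.orthonormalBasis {n : ℕ} (S : LGr n) : OrthonormalBasis (Fin n) ℝ S.1 :=
  (stdOrthonormalBasis ℝ S.1).reindex (finCongr S.finrank_eq)

theorem LGr.omega_eq_zero {n : ℕ} (S : LGr n) {u v : V n} (hu : u ∈ S.1) (hv : v ∈ S.1) :
    omega u v = 0 :=
  (S.2 v).1 hv u hu

/-- A real orthonormal basis of a Lagrangian is a unitary basis of ℂ^n: the imaginary part of the
Hermitian product is ω, which vanishes on S. -/
theorem LGr.inner_orthonormalBasis {n : ℕ} (S : LGr n) (i j : Fin n) :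
    inner ℂ (S.orthonormalBasis i : V n) (S.orthonormalBasis j) = if i = j then 1 else 0 := by
  have h1 := orthonormal_iff_ite.1 S.orthonormalBasis.orthonormal i j
  rw [Submodule.coe_inner, inner_real_eq_re] at h1
  have h2 := S.omega_eq_zero (S.orthonormalBasis i).2 (S.orthonormalBasis j).2
  rw [omega] at h2
  apply Complex.ext
  · rw [h1]
    split_ifs <;> simp
  · rw [h2]
    split_ifs <;> simp

/-- The standard Lagrangian subspace `ℝ^n`. -/
def realLag (n : ℕ) : LGr n :=
  ⟨{ carrier := {v | ∀ i, (v i).im = 0}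
     add_mem' := fun hu hv i => by simp [hu i, hv i]
     zero_mem' := fun i => by simp
     smul_mem' := fun c v hv i => by simp [hv i] }, by
    intro v
    change (∀ i, (v i).im = 0) ↔ ∀ u : V n, (∀ i, (u i).im = 0) → omega u v = 0
    constructor
    · intro hv u hu
      rw [omega, PiLp.inner_apply, Complex.im_sum]
      refine Finset.sum_eq_zero fun i _ => ?_
      simp [hu i, hv i]
    · intro h i
      have := h (EuclideanSpace.single i 1) (fun j => by
        by_cases hj : j = i
        · subst hj
          simp
        · simp [hj])
      rw [omega, EuclideanSpace.inner_single_left] at this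
      simpa using this⟩

theorem mem_realLag {n : ℕ} {v : V n} : v ∈ (realLag n).1 ↔ ∀ i, (v i).im = 0 := Iff.rfl

/-! ## The action of unitary matrices -/

/-- The unitary group of `ℂ^n`. -/
abbrev U (n : ℕ) : Type := Matrix.unitaryGroup (Fin n) ℂ

/-- The real linear map given by a complex matrix. -/
def act {n : ℕ} (A : Matrix (Fin n) (Fin n) ℂ) : V n →L[ℝ] V n :=
  (Matrix.toEuclideanCLM (n := Fin n) (𝕜 := ℂ) A).restrictScalars ℝ

theorem act_apply {n : ℕ} (A : Matrix (Fin n) (Fin n) ℂ) (v : V n) (i : Fin n) :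
    act A v i = ∑ j, A i j * v j := rfl

theorem act_mul {n : ℕ} (A B : Matrix (Fin n) (Fin n) ℂ) (v : V n) :
    act (A * B) v = act A (act B v) := by
  simp [act]

theorem act_one {n : ℕ} (v : V n) : act (1 : Matrix (Fin n) (Fin n) ℂ) v = v := by
  simp [act]

theorem act_inv_act {n : ℕ} (A : U n) (v : V n) :
    act ((A⁻¹ : U n) : Matrix (Fin n) (Fin n) ℂ) (act (A : Matrix (Fin n) (Fin n) ℂ) v) = v := by
  rw [← act_mul, ← Submonoid.coe_mul, inv_mul_cancel, Submonoid.coe_one, act_one]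

theorem act_act_inv {n : ℕ} (A : U n) (v : V n) :
    act (A : Matrix (Fin n) (Fin n) ℂ) (act ((A⁻¹ : U n) : Matrix (Fin n) (Fin n) ℂ) v) = v := by
  rw [← act_mul, ← Submonoid.coe_mul, mul_inv_cancel, Submonoid.coe_one, act_one]

theorem inner_act {n : ℕ} (A : U n) (u v : V n) :
    inner ℂ (act (A : Matrix (Fin n) (Fin n) ℂ) u) (act (A : Matrix (Fin n) (Fin n) ℂ) v) =
      inner ℂ u v := by
  have h : act (star (A : Matrix (Fin n) (Fin n) ℂ)) (act (A : Matrix (Fin n) (Fin n) ℂ) v) = v :=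
    act_inv_act A v
  conv_rhs => rw [← h]
  simp only [act, map_star, ContinuousLinearMap.coe_restrictScalars']
  rw [ContinuousLinearMap.star_eq_adjoint, ContinuousLinearMap.adjoint_inner_right]

theorem omega_act {n : ℕ} (A : U n) (u v : V n) :
    omega (act (A : Matrix (Fin n) (Fin n) ℂ) u) (act (A : Matrix (Fin n) (Fin n) ℂ) v) =
      omega u v := by
  rw [omega, inner_act, omega]

theorem continuous_act {n : ℕ} :
    Continuous (act : Matrix (Fin n) (Fin n) ℂ → (V n →L[ℝ] V n)) := by
  let f : Matrix (Fin n) (Fin n) ℂ →ₗ[ℝ] (V n →L[ℝ] V n) :=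
    { toFun := act
      map_add' := fun A B => by
        ext1 v
        simp [act]
      map_smul' := fun c A => by
        ext v i
        simp [act_apply, Finset.mul_sum, mul_assoc] }
  exact f.continuous_of_finiteDimensional

/-- A unitary matrix as a real linear isometry. -/
def actIso {n : ℕ} (A : U n) : V n ≃ₗᵢ[ℝ] V n where
  toFun := act (A : Matrix (Fin n) (Fin n) ℂ)
  invFun := act ((A⁻¹ : U n) : Matrix (Fin n) (Fin n) ℂ)
  map_add' := map_add _
  map_smul' := map_smul _
  left_inv := act_inv_act A
  right_inv := act_act_inv A
  norm_map' v := by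
    change ‖act (A : Matrix (Fin n) (Fin n) ℂ) v‖ = ‖v‖
    rw [@norm_eq_sqrt_re_inner ℂ, inner_act, ← @norm_eq_sqrt_re_inner ℂ]

theorem mem_map_act {n : ℕ} (A : U n) (S : Submodule ℝ (V n)) (v : V n) :
    v ∈ S.map (act (A : Matrix (Fin n) (Fin n) ℂ) : V n →ₗ[ℝ] V n) ↔
      act ((A⁻¹ : U n) : Matrix (Fin n) (Fin n) ℂ) v ∈ S := by
  constructor
  · rintro ⟨u, hu, rfl⟩
    change act _ (act _ u) ∈ S
    rwa [act_inv_act]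
  · intro h
    exact ⟨_, h, act_act_inv A v⟩

/-- The action of unitary matrices on the Lagrangian Grassmannian. -/
def lagMap {n : ℕ} (A : U n) (S : LGr n) : LGr n :=
  ⟨S.1.map (act (A : Matrix (Fin n) (Fin n) ℂ) : V n →ₗ[ℝ] V n), by
    intro v
    rw [mem_map_act, S.2]
    constructor
    · rintro h - ⟨u, hu, rfl⟩
      rw [← act_act_inv A v]
      exact (omega_act A _ _).trans (h u hu)
    · intro h u hu
      rw [← omega_act A, act_act_inv]
      exact h _ ⟨u, hu, rfl⟩⟩

theorem mem_lagMap {n : ℕ} (A : U n) (S : LGr n) (v : V n) :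
    v ∈ (lagMap A S).1 ↔ act ((A⁻¹ : U n) : Matrix (Fin n) (Fin n) ℂ) v ∈ S.1 :=
  mem_map_act A S.1 v

theorem lagMap_mul {n : ℕ} (A B : U n) (S : LGr n) : lagMap (A * B) S = lagMap A (lagMap B S) := by
  apply Subtype.ext
  ext v
  simp only [mem_lagMap, mul_inv_rev, Submonoid.coe_mul, act_mul]

theorem lagMap_one {n : ℕ} (S : LGr n) : lagMap 1 S = S := by
  apply Subtype.ext
  ext v
  simp only [mem_lagMap, inv_one, Submonoid.coe_one, act_one]

/-- The topology is pulled back from orthogonal projections, on which a unitary matrix acts by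
conjugation; joint continuity of the action follows. -/
theorem starProjection_lagMap {n : ℕ} (A : U n) (S : LGr n) :
    (lagMap A S).1.starProjection = (act (A : Matrix (Fin n) (Fin n) ℂ)).comp
      (S.1.starProjection.comp (act ((A⁻¹ : U n) : Matrix (Fin n) (Fin n) ℂ))) := by
  ext1 v
  exact Submodule.starProjection_map_apply (actIso A) S.1 v

theorem continuous_lagMap {n : ℕ} : Continuous (fun p : U n × LGr n => lagMap p.1 p.2) := by
  refine continuous_induced_rng.2 ?_
  have h : (fun S : LGr n => (S.1.starProjection : V n →L[ℝ] V n)) ∘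
      (fun p : U n × LGr n => lagMap p.1 p.2) = fun p =>
        (act (p.1 : Matrix (Fin n) (Fin n) ℂ)).comp
          (p.2.1.starProjection.comp (act ((p.1⁻¹ : U n) : Matrix (Fin n) (Fin n) ℂ))) := by
    funext p
    exact starProjection_lagMap p.1 p.2
  rw [h]
  have h1 : Continuous (fun p : U n × LGr n => act (p.1 : Matrix (Fin n) (Fin n) ℂ)) :=
    continuous_act.comp (continuous_subtype_val.comp continuous_fst)
  have h2 : Continuous (fun p : U n × LGr n =>
      act ((p.1⁻¹ : U n) : Matrix (Fin n) (Fin n) ℂ)) := by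
    refine continuous_act.comp ?_
    change Continuous (fun p : U n × LGr n => star (p.1 : Matrix (Fin n) (Fin n) ℂ))
    exact (continuous_subtype_val.comp continuous_fst).star
  have h3 : Continuous (fun p : U n × LGr n => (p.2.1.starProjection : V n →L[ℝ] V n)) :=
    (continuous_induced_dom (f := fun S : LGr n => (S.1.starProjection : V n →L[ℝ] V n))).comp
      continuous_snd
  exact h1.clm_comp (h3.clm_comp h2)

theorem norm_det_unitary {n : ℕ} (A : U n) : ‖(A : Matrix (Fin n) (Fin n) ℂ).det‖ = 1 := by
  have h := Matrix.det_of_mem_unitary A.2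
  exact CStarRing.norm_of_mem_unitary h

theorem sqPhase_act {n : ℕ} (A : U n) (xi : Fin n → V n) :
    sqPhase (fun i => act (A : Matrix (Fin n) (Fin n) ℂ) (xi i)) =
      (A : Matrix (Fin n) (Fin n) ℂ).det ^ 2 * sqPhase xi := by
  have h : (Matrix.of fun i j => act (A : Matrix (Fin n) (Fin n) ℂ) (xi j) i) =
      (A : Matrix (Fin n) (Fin n) ℂ) * (Matrix.of fun i j => xi j i) := by
    ext i j
    simp [act_apply, Matrix.mul_apply]
  rw [sqPhase, h, Matrix.det_mul, norm_mul, norm_det_unitary, sqPhase]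
  simp only [one_mul]
  ring

/-! ## The action on the Maslov cover -/

/-- The real phase of a point of the cover. -/
def Cover.ph {n : ℕ} (q : Cover n) : ℝ := q.1.2

/-- The point of the Lagrangian Grassmannian underlying a point of the cover. -/
def Cover.lgr {n : ℕ} (q : Cover n) : LGr n := q.1.1.2

theorem Cover.ext {n : ℕ} {q r : Cover n} (h1 : q.pt = r.pt) (h2 : q.lag = r.lag)
    (h3 : q.ph = r.ph) : q = r :=
  Subtype.ext (Prod.ext (Prod.ext h1 (Subtype.ext h2)) h3)

theorem Cover.continuous_pt {n : ℕ} : Continuous (Cover.pt : Cover n → V n) :=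
  continuous_fst.comp (continuous_fst.comp continuous_subtype_val)

theorem Cover.continuous_lgr {n : ℕ} : Continuous (Cover.lgr : Cover n → LGr n) :=
  continuous_snd.comp (continuous_fst.comp continuous_subtype_val)

theorem Cover.continuous_ph {n : ℕ} : Continuous (Cover.ph : Cover n → ℝ) :=
  continuous_snd.comp continuous_subtype_val

theorem Cover.exp_ph {n : ℕ} (q : Cover n) :
    Complex.exp (2 * Real.pi * Complex.I * q.ph) =
      sqPhase (fun i => (q.lgr.orthonormalBasis i : V n)) := by
  have h : (fun i => (q.lgr.orthonormalBasis.toBasis i : V n)) =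
      fun i => (q.lgr.orthonormalBasis i : V n) := by
    rw [OrthonormalBasis.coe_toBasis]
  exact (q.2 q.lgr.orthonormalBasis.toBasis).trans (congrArg sqPhase h)

theorem exists_int_of_exp_eq {s t : ℝ}
    (h : Complex.exp (2 * Real.pi * Complex.I * s) = Complex.exp (2 * Real.pi * Complex.I * t)) :
    ∃ k : ℤ, s - t = k := by
  obtain ⟨k, hk⟩ := Complex.exp_eq_exp_iff_exists_int.1 h
  refine ⟨k, ?_⟩
  have h1 : (2 * Real.pi * Complex.I) * (s : ℂ) = (2 * Real.pi * Complex.I) * ((t : ℂ) + k) := by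
    rw [hk]
    ring
  have h2 := mul_left_cancel₀ Complex.two_pi_I_ne_zero h1
  have h3 : s = t + k := by exact_mod_cast h2
  rw [h3]
  ring

/-- The source of all integrality: the phase modulo ℤ depends on the Lagrangian alone. -/
theorem Cover.exists_int_ph_sub {n : ℕ} {q r : Cover n} (h : q.lag = r.lag) :
    ∃ k : ℤ, q.ph - r.ph = k := by
  have h' : q.lgr = r.lgr := Subtype.ext h
  apply exists_int_of_exp_eq
  rw [q.exp_ph, r.exp_ph, h']

/-- The action on the cover of a unitary matrix with a real phase of its squared determinant. -/
def coverMap {n : ℕ} (A : U n) (r : ℝ) (h : Complex.exp (2 * Real.pi * Complex.I * r) =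
    (A : Matrix (Fin n) (Fin n) ℂ).det ^ 2) (q : Cover n) : Cover n :=
  ⟨((act (A : Matrix (Fin n) (Fin n) ℂ) q.pt, lagMap A q.lgr), q.ph + r), by
    intro xi
    -- The phase condition must hold for every basis of AS, so an arbitrary one is pulled back to S,
    -- where the condition for q applies.
    let e : (lagMap A q.lgr).1 ≃ₗ[ℝ] q.lgr.1 :=
      ((actIso A).toLinearEquiv.submoduleMap q.lgr.1).symm
    have he : ∀ v, act (A : Matrix (Fin n) (Fin n) ℂ) (e v) = v := fun v =>
      congrArg Subtype.val (((actIso A).toLinearEquiv.submoduleMap q.lgr.1).apply_symm_apply v)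
    have h1 := q.2 (xi.map e)
    change Complex.exp (2 * Real.pi * Complex.I * ((q.ph + r : ℝ) : ℂ)) = _
    change Complex.exp (2 * Real.pi * Complex.I * q.ph) = _ at h1
    have h2 : (fun i => (xi i : V n)) = fun i =>
        act (A : Matrix (Fin n) (Fin n) ℂ) ((xi.map e i : q.lgr.1) : V n) := by
      funext i
      rw [Module.Basis.map_apply, he]
    rw [h2, sqPhase_act, ← h, Complex.ofReal_add, mul_add, Complex.exp_add, h1, mul_comm]
    rfl⟩

theorem continuous_coverMap {n : ℕ} {X : Type*} [TopologicalSpace X] {A : X → U n} {r : X → ℝ}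
    (h : ∀ x, Complex.exp (2 * Real.pi * Complex.I * r x) =
      (A x : Matrix (Fin n) (Fin n) ℂ).det ^ 2) {q : X → Cover n} (hA : Continuous A)
    (hr : Continuous r) (hq : Continuous q) :
    Continuous (fun x => coverMap (A x) (r x) (h x) (q x)) := by
  have h1 : Continuous fun x => act (A x : Matrix (Fin n) (Fin n) ℂ) :=
    continuous_act.comp (continuous_subtype_val.comp hA)
  have h2 : Continuous fun x => act (A x : Matrix (Fin n) (Fin n) ℂ) (q x).pt :=
    h1.clm_apply (Cover.continuous_pt.comp hq)
  have h3' : Continuous fun x => (q x).lgr := Cover.continuous_lgr.comp hq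
  have h3 : Continuous ((fun p : U n × LGr n => lagMap p.1 p.2) ∘ fun x => (A x, (q x).lgr)) :=
    continuous_lagMap.comp (hA.prodMk h3')
  rw [Function.comp_def] at h3
  have h4 : Continuous fun x => (q x).ph + r x := (Cover.continuous_ph.comp hq).add hr
  exact Continuous.subtype_mk ((h2.prodMk h3).prodMk h4) _

theorem coverMap_coverMap {n : ℕ} {A B : U n} {r s : ℝ}
    (hA : Complex.exp (2 * Real.pi * Complex.I * r) = (A : Matrix (Fin n) (Fin n) ℂ).det ^ 2)
    (hB : Complex.exp (2 * Real.pi * Complex.I * s) = (B : Matrix (Fin n) (Fin n) ℂ).det ^ 2)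
    (hAB : Complex.exp (2 * Real.pi * Complex.I * ((r + s : ℝ) : ℂ)) =
      ((A * B : U n) : Matrix (Fin n) (Fin n) ℂ).det ^ 2) (q : Cover n) :
    coverMap A r hA (coverMap B s hB q) = coverMap (A * B) (r + s) hAB q := by
  apply Cover.ext
  · exact (act_mul _ _ _).symm
  · exact congrArg Subtype.val (lagMap_mul A B q.lgr).symm
  · change q.ph + s + r = q.ph + (r + s)
    ring

theorem coverMap_eq_self {n : ℕ} {A : U n} {r : ℝ}
    (h : Complex.exp (2 * Real.pi * Complex.I * r) = (A : Matrix (Fin n) (Fin n) ℂ).det ^ 2)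
    (hA : A = 1) (hr : r = 0) (q : Cover n) : coverMap A r h q = q := by
  subst hA hr
  apply Cover.ext
  · exact act_one _
  · exact congrArg Subtype.val (lagMap_one q.lgr)
  · exact add_zero _

theorem exp_neg_eq_det_inv {n : ℕ} {A : U n} {r : ℝ}
    (h : Complex.exp (2 * Real.pi * Complex.I * r) = (A : Matrix (Fin n) (Fin n) ℂ).det ^ 2) :
    Complex.exp (2 * Real.pi * Complex.I * ((-r : ℝ) : ℂ)) =
      ((A⁻¹ : U n) : Matrix (Fin n) (Fin n) ℂ).det ^ 2 := by
  have h1 : ((A⁻¹ : U n) : Matrix (Fin n) (Fin n) ℂ).det * (A : Matrix (Fin n) (Fin n) ℂ).det =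
      1 := by
    rw [← Matrix.det_mul, ← Submonoid.coe_mul, inv_mul_cancel, Submonoid.coe_one, Matrix.det_one]
  rw [Complex.ofReal_neg, mul_neg, Complex.exp_neg, h]
  exact inv_eq_of_mul_eq_one_left (by rw [← mul_pow, h1, one_pow])

/-- The homeomorphism of the cover given by a unitary matrix with a real phase of its squared
determinant. -/
def coverHomeo {n : ℕ} (A : U n) (r : ℝ) (h : Complex.exp (2 * Real.pi * Complex.I * r) =
    (A : Matrix (Fin n) (Fin n) ℂ).det ^ 2) : Cover n ≃ₜ Cover n where
  toFun := coverMap A r h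
  invFun := coverMap A⁻¹ (-r) (exp_neg_eq_det_inv h)
  left_inv q := by
    rw [coverMap_coverMap _ _ (by simp), coverMap_eq_self]
    · exact inv_mul_cancel A
    · exact neg_add_cancel r
  right_inv q := by
    rw [coverMap_coverMap _ _ (by simp), coverMap_eq_self]
    · exact mul_inv_cancel A
    · exact add_neg_cancel r
  continuous_toFun := continuous_coverMap _ continuous_const continuous_const continuous_id
  continuous_invFun := continuous_coverMap _ continuous_const continuous_const continuous_id

/-- The symplectomorphism given by a unitary matrix. -/
def unitarySymp {n : ℕ} (A : U n) : Symp n :=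
  ⟨(actIso A).toEquiv, (act (A : Matrix (Fin n) (Fin n) ℂ)).contDiff,
    (act ((A⁻¹ : U n) : Matrix (Fin n) (Fin n) ℂ)).contDiff, fun x u v => by
      have h : fderiv ℝ (actIso A).toEquiv x = act (A : Matrix (Fin n) (Fin n) ℂ) :=
        (act (A : Matrix (Fin n) (Fin n) ℂ)).fderiv
      rw [h, omega_act]⟩

/-- The graded symplectomorphism given by a unitary matrix with a real phase of its squared
determinant. -/
def unitaryGr {n : ℕ} (A : U n) (r : ℝ) (h : Complex.exp (2 * Real.pi * Complex.I * r) =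
    (A : Matrix (Fin n) (Fin n) ℂ).det ^ 2) : GrSymp n :=
  ⟨(unitarySymp A, coverHomeo A r h), by
    refine ⟨fun k q => ?_, fun q => ⟨rfl, ?_⟩⟩
    · apply Cover.ext
      · rfl
      · rfl
      · change q.ph - k + r = q.ph + r - k
        ring
    · have h : fderiv ℝ (unitarySymp A).1 q.pt = act (A : Matrix (Fin n) (Fin n) ℂ) :=
        (act (A : Matrix (Fin n) (Fin n) ℂ)).fderiv
      change (lagMap A q.lgr).1 = _
      rw [h]
      rfl⟩

theorem GrSymp_ext {n : ℕ} {F G : GrSymp n} (h : underlying n F = underlying n G)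
    (hph : ∀ q, (onCover n F q).ph = (onCover n G q).ph) : F = G := by
  have h1 : F.1.1 = G.1.1 := Subtype.ext h
  apply Subtype.ext
  refine Prod.ext h1 ?_
  ext1 q
  apply Cover.ext
  · rw [(F.2.2 q).1, (G.2.2 q).1, h1]
  · rw [(F.2.2 q).2, (G.2.2 q).2, h1]
  · exact hph q

theorem onCover_lag_eq {n : ℕ} {F G : GrSymp n} (h : underlying n F = underlying n G)
    (q : Cover n) : (onCover n F q).lag = (onCover n G q).lag := by
  have h1 : F.1.1 = G.1.1 := Subtype.ext h
  change (F.1.2 q).lag = (G.1.2 q).lag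
  rw [(F.2.2 q).2, (G.2.2 q).2, h1]

/-! ## Diagonal rotations -/

/-- The diagonal unitary matrix with entries `e^{2 π i θ_j}`. -/
def rotMat {n : ℕ} (θ : Fin n → ℝ) : U n :=
  ⟨Matrix.diagonal fun j => Complex.exp (2 * Real.pi * Complex.I * θ j), by
    rw [Matrix.mem_unitaryGroup_iff, Matrix.star_eq_conjTranspose, Matrix.diagonal_conjTranspose,
      Matrix.diagonal_mul_diagonal, ← Matrix.diagonal_one]
    congr 1
    funext j
    rw [Pi.star_apply, Complex.star_def, ← Complex.exp_conj, ← Complex.exp_add]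
    convert Complex.exp_zero using 2
    simp only [map_mul, map_ofNat, Complex.conj_ofReal, Complex.conj_I]
    ring⟩

theorem continuous_rotMat {n : ℕ} : Continuous (rotMat : (Fin n → ℝ) → U n) := by
  refine Continuous.subtype_mk (Continuous.matrix_diagonal ?_) _
  fun_prop

theorem rotMat_add {n : ℕ} (θ η : Fin n → ℝ) : rotMat (θ + η) = rotMat θ * rotMat η := by
  apply Subtype.ext
  rw [Submonoid.coe_mul]
  simp only [rotMat, Matrix.diagonal_mul_diagonal, ← Complex.exp_add]
  congr 1
  funext j
  rw [Pi.add_apply]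
  push_cast
  ring_nf

theorem rotMat_int {n : ℕ} (k : Fin n → ℤ) : rotMat (fun j => (k j : ℝ)) = 1 := by
  apply Subtype.ext
  change Matrix.diagonal _ = (1 : Matrix (Fin n) (Fin n) ℂ)
  rw [← Matrix.diagonal_one]
  congr 1
  funext j
  rw [Complex.ofReal_intCast, mul_comm, Complex.exp_int_mul_two_pi_mul_I]

theorem exp_two_sum_eq {n : ℕ} (θ : Fin n → ℝ) :
    Complex.exp (2 * Real.pi * Complex.I * ((2 * ∑ j, θ j : ℝ) : ℂ)) =
      (rotMat θ : Matrix (Fin n) (Fin n) ℂ).det ^ 2 := by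
  rw [rotMat, Matrix.det_diagonal, ← Complex.exp_sum, ← Complex.exp_nat_mul, ← Finset.mul_sum]
  push_cast
  ring_nf

/-- The graded symplectomorphism `z_j ↦ e^{2 π i θ_j} z_j`, with phase increased by `2 ∑ θ_j`. -/
def rot {n : ℕ} (θ : Fin n → ℝ) : GrSymp n := unitaryGr (rotMat θ) (2 * ∑ j, θ j) (exp_two_sum_eq θ)

theorem ph_rot {n : ℕ} (θ : Fin n → ℝ) (q : Cover n) :
    (onCover n (rot θ) q).ph = q.ph + 2 * ∑ j, θ j := rfl

theorem ph_shiftGr {n : ℕ} (k : ℤ) (q : Cover n) : (onCover n (shiftGr k) q).ph = q.ph - k := rfl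

theorem underlying_rot {n : ℕ} (θ : Fin n → ℝ) (l : Fin n → ℂˣ)
    (h : ∀ j, (l j : ℂ) = Complex.exp (2 * Real.pi * Complex.I * θ j)) :
    underlying n (rot θ) = diagAct n l := by
  ext v j
  change act (rotMat θ : Matrix (Fin n) (Fin n) ℂ) v j = l j * v j
  rw [act_apply, h]
  simp [rotMat, Matrix.diagonal_apply]

theorem rot_add {n : ℕ} (θ η : Fin n → ℝ) : rot (θ + η) = rot θ * rot η := by
  apply GrSymp_ext
  · rw [map_mul]
    ext1 v
    change act (rotMat (θ + η) : Matrix (Fin n) (Fin n) ℂ) v = act (rotMat θ) (act (rotMat η) v)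
    rw [rotMat_add, ← act_mul]
    rfl
  · intro q
    rw [map_mul]
    change _ = (onCover n (rot θ) (onCover n (rot η) q)).ph
    simp only [ph_rot, Pi.add_apply, Finset.sum_add_distrib]
    ring

/-- The underlying rotation is trivial but the phase still rises by 2∑k_j; as [k] lowers the phase
by k, the shift is negative. -/
theorem rot_int {n : ℕ} (k : Fin n → ℤ) : rot (fun j => (k j : ℝ)) = shiftGr (-2 * ∑ j, k j) := by
  apply GrSymp_ext
  · ext1 v
    change act (rotMat (fun j => (k j : ℝ)) : Matrix (Fin n) (Fin n) ℂ) v = v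
    rw [rotMat_int]
    exact act_one v
  · intro q
    rw [ph_rot, ph_shiftGr]
    push_cast
    ring

theorem rot_zero {n : ℕ} : rot (0 : Fin n → ℝ) = 1 := by
  have h := rot_add (0 : Fin n → ℝ) 0
  rw [add_zero] at h
  exact left_eq_mul.1 h

theorem rot_nsmul {n : ℕ} (m : ℕ) (θ : Fin n → ℝ) : rot (m • θ) = rot θ ^ m := by
  induction m with
  | zero => rw [zero_smul, rot_zero, pow_zero]
  | succ m ih => rw [succ_nsmul, rot_add, ih, pow_succ]

theorem rot_mul_shiftGr {n : ℕ} (θ : Fin n → ℝ) (k : ℤ) :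
    rot θ * shiftGr k = shiftGr k * rot θ := by
  apply GrSymp_ext
  · rw [map_mul, map_mul]
    rfl
  · intro q
    rw [map_mul, map_mul]
    change (onCover n (rot θ) (onCover n (shiftGr k) q)).ph =
      (onCover n (shiftGr k) (onCover n (rot θ) q)).ph
    simp only [ph_rot, ph_shiftGr]
    ring

theorem continuous_rot {n : ℕ} {X : Type*} [TopologicalSpace X] {θ : X → Fin n → ℝ}
    {q : X → Cover n} (hθ : Continuous θ) (hq : Continuous q) :
    Continuous (fun x => onCover n (rot (θ x)) (q x)) := by
  refine continuous_coverMap (A := fun x => rotMat (θ x)) (r := fun x => 2 * ∑ j, θ x j) 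
    (fun x => exp_two_sum_eq (θ x)) (continuous_rotMat.comp hθ) ?_ hq
  fun_prop

/-! ## Diagonalization of unitary matrices -/

open scoped Matrix.Norms.L2Operator in
-- Apply the functional calculus with `Complex.arg`. Its jump is harmless because the spectrum is
-- finite, so any function is continuous on it.
theorem exists_isHermitian_exp {n : ℕ} (A : U n) : ∃ H : Matrix (Fin n) (Fin n) ℂ,
    H.IsHermitian ∧ (A : Matrix (Fin n) (Fin n) ℂ) = NormedSpace.exp (Complex.I • H) := by
  have hsp : (spectrum ℂ (A : Matrix (Fin n) (Fin n) ℂ)).Finite := Matrix.finite_spectrum _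
  have hc : ContinuousOn (Complex.ofReal ∘ Complex.arg : ℂ → ℂ)
      (spectrum ℂ (A : Matrix (Fin n) (Fin n) ℂ)) := hsp.continuousOn _
  refine ⟨cfc (Complex.ofReal ∘ Complex.arg : ℂ → ℂ) (A : Matrix (Fin n) (Fin n) ℂ),
    IsSelfAdjoint.cfc_arg (A : Matrix (Fin n) (Fin n) ℂ), ?_⟩
  rw [← CFC.exp_eq_normedSpace_exp (𝕜 := ℂ), ← cfc_comp_smul .., ← cfc_comp' ..]
  conv_lhs => rw [← cfc_id' ℂ (A : Matrix (Fin n) (Fin n) ℂ)]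
  refine cfc_congr fun y hy ↦ ?_
  have hy₁ : ‖y‖ = 1 := spectrum.norm_eq_one_of_unitary A.2 hy
  have : Complex.I * y.arg = Complex.log y :=
    Complex.ext (by simp [Complex.log_re, hy₁]) (by simp [Complex.log_im])
  have h0 : y ≠ 0 := by
    rintro rfl
    simp at hy₁
  simpa [← Complex.exp_eq_exp_ℂ, this] using (Complex.exp_log h0).symm

theorem exists_conj_rotMat {n : ℕ} (A : U n) :
    ∃ (W : U n) (θ : Fin n → ℝ), A = W * rotMat θ * W⁻¹ := by
  obtain ⟨H, hH, hA⟩ := exists_isHermitian_exp A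
  refine ⟨hH.eigenvectorUnitary, fun j => hH.eigenvalues j / (2 * Real.pi), ?_⟩
  apply Subtype.ext
  have hs := hH.spectral_theorem
  rw [Unitary.conjStarAlgAut_apply] at hs
  have hinv : (star (hH.eigenvectorUnitary : Matrix (Fin n) (Fin n) ℂ)) =
      (hH.eigenvectorUnitary : Matrix (Fin n) (Fin n) ℂ)⁻¹ :=
    (Matrix.inv_eq_left_inv (Matrix.UnitaryGroup.star_mul_self _)).symm
  have hu : IsUnit (hH.eigenvectorUnitary : Matrix (Fin n) (Fin n) ℂ) :=
    Unitary.isUnit_coe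
  have h2 : Complex.I • H = (hH.eigenvectorUnitary : Matrix (Fin n) (Fin n) ℂ) *
      Matrix.diagonal (fun j => Complex.I * (hH.eigenvalues j : ℂ)) *
      (hH.eigenvectorUnitary : Matrix (Fin n) (Fin n) ℂ)⁻¹ := by
    conv_lhs => rw [hs]
    rw [← hinv, ← smul_mul_assoc, ← mul_smul_comm, ← Matrix.diagonal_smul]
    rfl
  rw [hA, h2, Matrix.exp_conj _ _ hu, Matrix.exp_diagonal, ← hinv]
  change _ = (hH.eigenvectorUnitary : Matrix (Fin n) (Fin n) ℂ) * _ *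
    star (hH.eigenvectorUnitary : Matrix (Fin n) (Fin n) ℂ)
  congr 2
  rw [rotMat]
  congr 1
  funext j
  rw [Pi.coe_exp, ← Complex.exp_eq_exp_ℂ]
  congr 1
  push_cast
  have : (Real.pi : ℂ) ≠ 0 := by exact_mod_cast Real.pi_ne_zero
  field_simp

/-! ## Connectedness of the Maslov cover modulo shifts -/

theorem LGr.mem_iff_orthonormalBasis {n : ℕ} (S : LGr n) (v : V n) :
    v ∈ S.1 ↔ ∀ i, omega (S.orthonormalBasis i : V n) v = 0 := by
  rw [S.2]
  refine ⟨fun h i => h _ (S.orthonormalBasis i).2, fun h u hu => ?_⟩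
  have h1 := congrArg Subtype.val (S.orthonormalBasis.sum_repr ⟨u, hu⟩)
  rw [Submodule.coe_sum] at h1
  simp only [Submodule.coe_smul] at h1
  rw [omega_eq_inner, ← h1, Finset.smul_sum, sum_inner]
  refine Finset.sum_eq_zero fun i _ => ?_
  rw [smul_comm, inner_smul_left, ← omega_eq_inner, h i, mul_zero]

/-- Take for A the matrix whose columns are an orthonormal basis of S. The entries of A⁻¹v are the
Hermitian products with that basis, and v lies in S exactly when their imaginary parts, the values
of ω, all vanish. -/
theorem exists_lagMap_realLag {n : ℕ} (S : LGr n) : ∃ A : U n, lagMap A (realLag n) = S := by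
  let M : Matrix (Fin n) (Fin n) ℂ := Matrix.of fun i j => (S.orthonormalBasis j : V n) i
  have hM : ∀ (i : Fin n) (v : V n), act (star M) v i = inner ℂ (S.orthonormalBasis i : V n) v := by
    intro i v
    rw [act_apply, PiLp.inner_apply]
    refine Finset.sum_congr rfl fun k _ => ?_
    rw [RCLike.inner_apply, mul_comm]
    rfl
  have hU : M ∈ Matrix.unitaryGroup (Fin n) ℂ := by
    rw [Matrix.mem_unitaryGroup_iff']
    ext i j
    rw [Matrix.one_apply, ← S.inner_orthonormalBasis i j, ← hM]
    rfl
  refine ⟨⟨M, hU⟩, Subtype.ext ?_⟩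
  ext v
  rw [mem_lagMap, mem_realLag, S.mem_iff_orthonormalBasis]
  refine forall_congr' fun i => ?_
  change (act (star M) v i).im = 0 ↔ _
  rw [hM, omega]

theorem det_conj_unitary {n : ℕ} (W A : U n) :
    ((W * A * W⁻¹ : U n) : Matrix (Fin n) (Fin n) ℂ).det =
      (A : Matrix (Fin n) (Fin n) ℂ).det := by
  have h : (W : Matrix (Fin n) (Fin n) ℂ).det * ((W⁻¹ : U n) : Matrix (Fin n) (Fin n) ℂ).det =
      1 := by
    rw [← Matrix.det_mul, ← Submonoid.coe_mul, mul_inv_cancel, Submonoid.coe_one, Matrix.det_one]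
  rw [Submonoid.coe_mul, Submonoid.coe_mul, Matrix.det_mul, Matrix.det_mul, mul_right_comm, h,
    one_mul]

/-- The point of the cover with the same Lagrangian subspace and phase at another base point. -/
def Cover.rebase {n : ℕ} (x : V n) (q : Cover n) : Cover n := ⟨((x, q.lgr), q.ph), q.2⟩

theorem Cover.continuous_rebase {n : ℕ} (q : Cover n) :
    Continuous (fun x => Cover.rebase x q) :=
  Continuous.subtype_mk (by fun_prop) _

/-- With A = W rot(θ) W⁻¹, scaling θ by s ∈ [0, 1] joins 1 to A in the unitary group. The phase
2s∑θ_j of the squared determinant is continuous in s, so the path acts on the cover. -/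
theorem exists_path_realLag {n : ℕ} (q : Cover n) : ∃ γ : ℝ → Cover n, Continuous γ ∧
    (γ 0).lgr = realLag n ∧ γ 1 = q := by
  obtain ⟨A, hA⟩ := exists_lagMap_realLag q.lgr
  obtain ⟨W, θ, hW⟩ := exists_conj_rotMat A
  have hdet : ∀ s : ℝ, Complex.exp (2 * Real.pi * Complex.I * ((2 * ∑ j, (s • θ) j : ℝ) : ℂ)) =
      ((W * rotMat (s • θ) * W⁻¹ : U n) : Matrix (Fin n) (Fin n) ℂ).det ^ 2 := fun s => by
    rw [det_conj_unitary, exp_two_sum_eq]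
  have h1 : Complex.exp (2 * Real.pi * Complex.I * ((2 * ∑ j, θ j : ℝ) : ℂ)) =
      (A : Matrix (Fin n) (Fin n) ℂ).det ^ 2 := by
    rw [hW, det_conj_unitary, exp_two_sum_eq]
  -- The start of the path is q carried back to ℝ^n, so that the endpoint is q itself and not a
  -- shift of it.
  let q₀ := coverMap A⁻¹ _ (exp_neg_eq_det_inv h1) q
  have hrot : Continuous fun s : ℝ => rotMat (s • θ) := continuous_rotMat.comp (by fun_prop)
  have hcont : Continuous fun s : ℝ => W * rotMat (s • θ) * W⁻¹ := by fun_prop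
  have h0 : rotMat (0 : Fin n → ℝ) = 1 := by
    rw [← rotMat_int (0 : Fin n → ℤ)]
    congr 1
    funext j
    simp
  refine ⟨fun s => coverMap (W * rotMat (s • θ) * W⁻¹) _ (hdet s) q₀,
    continuous_coverMap hdet hcont (by fun_prop) continuous_const, ?_, ?_⟩
  · beta_reduce
    rw [coverMap_eq_self (hdet 0)]
    · change lagMap A⁻¹ q.lgr = _
      rw [← hA, ← lagMap_mul, inv_mul_cancel, lagMap_one]
    · rw [zero_smul, h0, mul_one, mul_inv_cancel]
    · simp
  · have hA1 : W * rotMat ((1 : ℝ) • θ) * W⁻¹ = A := by rw [one_smul, hW]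
    have h2 : 2 * ∑ j, ((1 : ℝ) • θ) j + -(2 * ∑ j, θ j) = 0 := by simp
    change coverMap _ _ (hdet 1) (coverMap A⁻¹ _ (exp_neg_eq_det_inv h1) q) = q
    rw [coverMap_coverMap _ _ (by rw [h2, hA1, mul_inv_cancel]; simp), coverMap_eq_self]
    · rw [hA1, mul_inv_cancel]
    · exact h2

theorem eq_of_continuous_of_forall_int {f : ℝ → ℝ} (hf : Continuous f)
    (h : ∀ s, ∃ k : ℤ, f s = k) (s t : ℝ) : f s = f t := by
  choose k hk using h
  have hk' : f = fun s => (k s : ℝ) := funext hk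
  have hc : Continuous k := by
    rw [Int.isClosedEmbedding_coe_real.isInducing.continuous_iff]
    rw [hk'] at hf
    exact hf
  rw [hk, hk, PreconnectedSpace.constant inferInstance hc]

theorem ph_eq_of_path {n : ℕ} {γ : ℝ → Cover n} {δ : Cover n → ℝ} (hγ : Continuous γ)
    (hδ : Continuous δ) (h : ∀ q, ∃ k : ℤ, δ q = k) : δ (γ 0) = δ (γ 1) :=
  eq_of_continuous_of_forall_int (hδ.comp hγ) (fun s => h (γ s)) 0 1

/-- Integer-valued continuous functions on the cover that are invariant under shifts are
constant. -/
theorem eq_of_shift_invariant {n : ℕ} {δ : Cover n → ℝ} (hδ : Continuous δ)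
    (h : ∀ q, ∃ k : ℤ, δ q = k) (hs : ∀ k q, δ (shiftFun k q) = δ q) (q r : Cover n) :
    δ q = δ r := by
  have key : ∀ q, ∃ q', q'.lgr = realLag n ∧ q'.pt = 0 ∧ δ q = δ q' := by
    intro q
    obtain ⟨γ, hγ, h0, h1⟩ := exists_path_realLag q
    -- After deforming the Lagrangian to ℝ^n, contract the base point radially to the origin.
    refine ⟨(γ 0).rebase 0, h0, rfl, ?_⟩
    have hpath : Continuous fun s : ℝ => (γ 0).rebase (s • (γ 0).pt) :=
      (Cover.continuous_rebase _).comp (by fun_prop)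
    have h2 := ph_eq_of_path hpath hδ h
    have h3 := ph_eq_of_path hγ hδ h
    simp only [zero_smul, one_smul] at h2
    rw [h2, ← h1, ← h3]
    rfl
  obtain ⟨q', hq1, hq2, hq3⟩ := key q
  obtain ⟨r', hr1, hr2, hr3⟩ := key r
  have hlag : q'.lag = r'.lag := congrArg Subtype.val (hq1.trans hr1.symm)
  obtain ⟨k, hk⟩ := Cover.exists_int_ph_sub hlag
  -- Two points over (0, ℝ^n) differ by a shift, which is where shift invariance enters.
  have hqr : shiftFun k q' = r' := by
    apply Cover.ext
    · exact hq2.trans hr2.symm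
    · exact hlag
    · change q'.ph - k = r'.ph
      rw [← hk]
      ring
  rw [hq3, hr3, ← hqr, hs]

/-- The determinant of a real basis of ℝ^n is real and nonzero, so its square is positive. This
supplies a point of the cover of phase 0. -/
theorem sqPhase_of_basis_realLag {n : ℕ} (xi : Module.Basis (Fin n) ℝ (realLag n).1) :
    sqPhase (fun i => (xi i : V n)) = 1 := by
  let N : Matrix (Fin n) (Fin n) ℝ := Matrix.of fun i j => ((xi j : V n) i).re
  have hN : (Matrix.of fun i j => (xi j : V n) i) = N.map Complex.ofRealHom := by
    ext i j
    exact (Complex.ext rfl (mem_realLag.1 (xi j).2 i) :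
      (xi j : V n) i = ((((xi j : V n) i).re : ℝ) : ℂ))
  have hdet : (Matrix.of fun i j => (xi j : V n) i).det = ((N.det : ℝ) : ℂ) := by
    rw [hN]
    exact (Complex.ofRealHom.map_det N).symm
  have he : ∀ j, EuclideanSpace.single j (1 : ℂ) ∈ (realLag n).1 := fun j =>
    mem_realLag.2 fun i => by by_cases h : i = j <;> simp [h]
  have hinv : N * (Matrix.of fun k j => xi.repr ⟨_, he j⟩ k) = 1 := by
    ext i j
    have h1 := congrArg (fun v : (realLag n).1 => ((v : V n) i).re) (xi.sum_repr ⟨_, he j⟩)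
    simp only [Submodule.coe_sum, Submodule.coe_smul, PiLp.smul_apply, WithLp.ofLp_sum,
      Finset.sum_apply, Complex.re_sum] at h1
    rw [Matrix.mul_apply, Matrix.one_apply]
    convert h1 using 1
    · refine Finset.sum_congr rfl fun k _ => ?_
      simp [N, mul_comm]
    · by_cases h : i = j <;> simp [h]
  have h0 : N.det ≠ 0 := by
    intro h
    have := congrArg Matrix.det hinv
    rw [Matrix.det_mul, h, zero_mul, Matrix.det_one] at this
    exact zero_ne_one this
  rw [sqPhase, hdet, Complex.norm_real, ← Complex.ofReal_pow, ← Complex.ofReal_pow,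
    Real.norm_eq_abs, sq_abs, div_self]
  exact_mod_cast pow_ne_zero 2 h0

instance {n : ℕ} : Nonempty (Cover n) :=
  ⟨⟨((0, realLag n), 0), fun xi => by
    rw [sqPhase_of_basis_realLag xi]
    simp⟩⟩

theorem exists_eq_shiftGr {n : ℕ} (F : GrSymp n) (hF : underlying n F = 1) :
    ∃ k : ℤ, F = shiftGr k := by
  have h1 : underlying n F = underlying n 1 := by rw [hF, map_one]
  obtain ⟨q₀⟩ : Nonempty (Cover n) := inferInstance
  have hint : ∀ q, ∃ k : ℤ, (onCover n F q).ph - q.ph = k := fun q =>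
    Cover.exists_int_ph_sub ((onCover_lag_eq h1 q).trans (by rw [map_one]; rfl))
  have hcont : Continuous fun q => (onCover n F q).ph - q.ph :=
    (Cover.continuous_ph.comp (onCover n F).continuous).sub Cover.continuous_ph
  have hs : ∀ k q, (onCover n F (shiftFun k q)).ph - (shiftFun k q).ph =
      (onCover n F q).ph - q.ph := by
    intro k q
    have h2 : onCover n F (shiftFun k q) = shiftFun k (onCover n F q) := F.2.1 k q
    rw [h2]
    change (onCover n F q).ph - k - (q.ph - k) = _
    ring
  obtain ⟨k, hk⟩ := hint q₀
  -- The sign is reversed because [k] lowers the phase.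
  refine ⟨-k, GrSymp_ext hF fun q => ?_⟩
  have h3 := eq_of_shift_invariant hcont hint hs q q₀
  rw [ph_shiftGr]
  push_cast
  linarith

/-! ## Graded lifts of the diagonal symmetries -/

theorem flow_eq_exp {n : ℕ} (a : Fin n → ℕ) (t : ℝ) (j : Fin n) :
    (flow a t j : ℂ) =
      Complex.exp (2 * Real.pi * Complex.I * ((t • fun j : Fin n => weight a j) j : ℝ)) :=
  flow_apply a t j

/-- The graded lift of the diagonal flow. -/
def flowGr {n : ℕ} (a : Fin n → ℕ) (t : ℝ) : GrSymp n := rot (t • fun j : Fin n => weight a j)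

theorem underlying_flowGr {n : ℕ} (a : Fin n → ℕ) (t : ℝ) :
    underlying n (flowGr a t) = diagAct n (flow a t) :=
  underlying_rot _ _ (flow_eq_exp a t)

/-- The graded symplectomorphism `φ̃_a`. -/
def gradedGenerator {n : ℕ} {a : Fin n → ℕ} (ha : ∀ i, a i ≠ 0) : GamHat a :=
  ⟨flowGr a 1, flow a 1, flow_one_mem ha, (underlying_flowGr a 1).symm⟩

theorem projHat_gradedGenerator {n : ℕ} {a : Fin n → ℕ} (ha : ∀ i, a i ≠ 0) :
    projHat a (gradedGenerator ha) = generator ha := by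
  apply Subtype.ext
  apply diagAct_injective n
  rw [diagAct_projHat]
  exact underlying_flowGr a 1

theorem continuous_slice {n : ℕ} {G : ℝ → GrSymp n}
    (hG : Continuous fun s : ℝ × Cover n => onCover n (G s.1) s.2) (q : Cover n) :
    Continuous fun t => onCover n (G t) q := by
  have h := hG.comp (f := fun t : ℝ => (t, q)) (by fun_prop)
  rw [Function.comp_def] at h
  exact h

/-- Uniqueness: at each point of the cover the phases of two lifts of the flow differ by an integer
depending continuously on t, and it is 0 at t = 0. -/
theorem isFlowLift_iff {n : ℕ} {a : Fin n → ℕ} (ha : ∀ i, a i ≠ 0) (F : GamHat a) :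
    IsFlowLift a F ↔ F = gradedGenerator ha := by
  have h0 : flowGr a 0 = 1 := by rw [flowGr, zero_smul, rot_zero]
  have hc : Continuous fun s : ℝ × Cover n => onCover n (flowGr a s.1) s.2 :=
    continuous_rot (by fun_prop) continuous_snd
  constructor
  · rintro ⟨G, hG0, hG1, hG, hGc⟩
    have hu : ∀ t, underlying n (G t) = underlying n (flowGr a t) := fun t => by
      rw [hG, underlying_flowGr]
    apply Subtype.ext
    rw [← hG1]
    refine GrSymp_ext (hu 1) fun q => ?_
    have hδ : Continuous fun t => (onCover n (G t) q).ph - (onCover n (flowGr a t) q).ph :=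
      (Cover.continuous_ph.comp (continuous_slice hGc q)).sub
        (Cover.continuous_ph.comp (continuous_slice hc q))
    have h := eq_of_continuous_of_forall_int hδ
      (fun t => Cover.exists_int_ph_sub (onCover_lag_eq (hu t) q)) 0 1
    simp only [hG0, h0, sub_self] at h
    exact sub_eq_zero.1 h.symm
  · rintro rfl
    exact ⟨flowGr a, h0, rfl, underlying_flowGr a, hc⟩

theorem gradedGenerator_pow {n : ℕ} {a : Fin n → ℕ} (ha : ∀ i, a i ≠ 0) :
    gradedGenerator ha ^ dInv a = shiftHat a (Multiplicative.ofAdd (shiftExp a)) := by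
  apply Subtype.ext
  change flowGr a 1 ^ dInv a = shiftGr (shiftExp a)
  have hd : (dInv a : ℝ) ≠ 0 := Nat.cast_ne_zero.2 (dInv_ne_zero ha)
  -- Clearing the common denominator d(a) makes all weights integers, so `rot_int` applies.
  have h : (dInv a • (1 : ℝ) • fun j : Fin n => weight a j) = fun j : Fin n => (coef a j : ℝ) := by
    funext j
    simp only [one_smul, Pi.smul_apply, weight, nsmul_eq_mul]
    field_simp
  rw [flowGr, ← rot_nsmul, h, rot_int, shiftExp_eq_sum, Finset.sum_range]

/-! ### Exactness of the geometric extension -/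

theorem shiftGr_injective (n : ℕ) : Function.Injective (shiftGr : ℤ → GrSymp n) := by
  intro j k h
  obtain ⟨q⟩ : Nonempty (Cover n) := inferInstance
  have h1 := congrArg (fun F => (onCover n F q).ph) h
  simp only [ph_shiftGr] at h1
  exact_mod_cast (sub_right_inj.1 h1)

theorem shiftHat_injective {n : ℕ} (a : Fin n → ℕ) : Function.Injective (shiftHat a) := by
  intro j k h
  exact Multiplicative.toAdd.injective (shiftGr_injective n (congrArg Subtype.val h))

theorem projHat_eq_one_iff {n : ℕ} (a : Fin n → ℕ) (F : GamHat a) :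
    projHat a F = 1 ↔ ∃ k : ℤ, F = shiftHat a (Multiplicative.ofAdd k) := by
  have h := diagAct_projHat a F
  constructor
  · intro h1
    rw [h1, Subgroup.coe_one, map_one] at h
    obtain ⟨k, hk⟩ := exists_eq_shiftGr (F : GrSymp n) h.symm
    exact ⟨k, Subtype.ext hk⟩
  · rintro ⟨k, rfl⟩
    apply Subtype.ext
    apply diagAct_injective n
    rw [h, Subgroup.coe_one, map_one]
    rfl

theorem exact_GamHat {n : ℕ} [NeZero n] (a : Fin n → ℕ) (ha : ∀ i, a i ≠ 0) :
    Function.Injective (shiftHat a) ∧ (shiftHat a).range = (projHat a).ker ∧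
      Function.Surjective (projHat a) := by
  refine ⟨shiftHat_injective a, ?_, fun g => ?_⟩
  · ext F
    rw [MonoidHom.mem_ker, projHat_eq_one_iff, MonoidHom.mem_range]
    exact ⟨fun ⟨k, hk⟩ => ⟨k.toAdd, hk.symm⟩, fun ⟨k, hk⟩ => ⟨Multiplicative.ofAdd k, hk.symm⟩⟩
  · obtain ⟨i, rfl⟩ := exists_generator_zpow ha g
    exact ⟨gradedGenerator ha ^ i, by rw [map_zpow, projHat_gradedGenerator]⟩

/-! ## The isomorphism of extensions -/

theorem commute_gradedGenerator_shiftHat {n : ℕ} {a : Fin n → ℕ} (ha : ∀ i, a i ≠ 0)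
    (k : Multiplicative ℤ) : Commute (gradedGenerator ha) (shiftHat a k) :=
  Subtype.ext (rot_mul_shiftGr _ _)

/-- The map `(i, j) ↦ φ̃_a ^ i [j]`. -/
def presHat {n : ℕ} {a : Fin n → ℕ} (ha : ∀ i, a i ≠ 0) : Multiplicative (ℤ × ℤ) →* GamHat a where
  toFun x := gradedGenerator ha ^ x.toAdd.1 * shiftHat a (Multiplicative.ofAdd x.toAdd.2)
  map_one' := by simp
  map_mul' x y := by
    -- Multiplicativity rests on shifts commuting with φ̃_a.
    have h := ((commute_gradedGenerator_shiftHat ha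
      (Multiplicative.ofAdd x.toAdd.2)).zpow_left y.toAdd.1).eq
    simp only [toAdd_mul, Prod.fst_add, Prod.snd_add, zpow_add, ofAdd_add, map_mul]
    rw [mul_assoc, mul_assoc, ← mul_assoc (shiftHat a _), ← h, mul_assoc]

/-- The map `(i, j) ↦ i τ + j T`. -/
def presTilde {n : ℕ} [NeZero n] (a : Fin n → ℕ) :
    Multiplicative (ℤ × ℤ) →* Multiplicative (LTilde a) :=
  AddMonoidHom.toMultiplicative
    ((zmultiplesHom _ (tau a)).coprod (zmultiplesHom _ (gen a Gen.T)))

theorem presHat_apply {n : ℕ} {a : Fin n → ℕ} (ha : ∀ i, a i ≠ 0) (i j : ℤ) :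
    presHat ha (Multiplicative.ofAdd (i, j)) =
      gradedGenerator ha ^ i * shiftHat a (Multiplicative.ofAdd j) := rfl

theorem presTilde_apply {n : ℕ} [NeZero n] (a : Fin n → ℕ) (i j : ℤ) :
    presTilde a (Multiplicative.ofAdd (i, j)) =
      Multiplicative.ofAdd (i • tau a + j • gen a Gen.T) := rfl

theorem presHat_surjective {n : ℕ} [NeZero n] {a : Fin n → ℕ} (ha : ∀ i, a i ≠ 0) :
    Function.Surjective (presHat ha) := by
  intro F
  obtain ⟨i, hi⟩ := exists_generator_zpow ha (projHat a F)
  obtain ⟨j, hj⟩ := (projHat_eq_one_iff a ((gradedGenerator ha ^ i)⁻¹ * F)).1 (by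
    rw [map_mul, map_inv, map_zpow, projHat_gradedGenerator, hi, inv_mul_cancel])
  exact ⟨Multiplicative.ofAdd (i, j), by rw [presHat_apply, ← hj, mul_inv_cancel_left]⟩

theorem presTilde_surjective {n : ℕ} [NeZero n] (a : Fin n → ℕ) :
    Function.Surjective (presTilde a) := by
  intro l
  obtain ⟨i, j, h⟩ := exists_tau_add_T a l.toAdd
  exact ⟨Multiplicative.ofAdd (i, j), congrArg Multiplicative.ofAdd h.symm⟩

theorem projHat_presHat {n : ℕ} {a : Fin n → ℕ} (ha : ∀ i, a i ≠ 0) (i j : ℤ) :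
    projHat a (presHat ha (Multiplicative.ofAdd (i, j))) = generator ha ^ i := by
  rw [presHat_apply, map_mul, map_zpow, projHat_gradedGenerator,
    (projHat_eq_one_iff a _).2 ⟨j, rfl⟩, mul_one]

/-- Projecting to Γ_a^0 forces d(a) to divide i. Then φ̃_a^i is itself a shift, and injectivity of k
↦ [k] fixes j. -/
theorem presHat_eq_one_iff {n : ℕ} [NeZero n] {a : Fin n → ℕ} (ha : ∀ i, a i ≠ 0) (i j : ℤ) :
    presHat ha (Multiplicative.ofAdd (i, j)) = 1 ↔
      ∃ m : ℤ, i = m * dInv a ∧ j = -(m * shiftExp a) := by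
  have key : ∀ m : ℤ, presHat ha (Multiplicative.ofAdd (m * dInv a, j)) =
      shiftHat a (Multiplicative.ofAdd (m * shiftExp a + j)) := fun m => by
    rw [presHat_apply, mul_comm m, zpow_mul, zpow_natCast, gradedGenerator_pow, ← map_zpow,
      ← map_mul, ← ofAdd_zsmul, ← ofAdd_add, smul_eq_mul]
  constructor
  · intro h
    have h1 := projHat_presHat ha i j
    rw [h, map_one] at h1
    obtain ⟨m, hm⟩ := (generator_zpow_eq_one_iff ha i).1 h1.symm
    rw [mul_comm] at hm
    rw [hm, key, ← map_one (shiftHat a)] at h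
    have h2 : m * shiftExp a + j = 0 := shiftHat_injective a h
    exact ⟨m, hm, by linarith⟩
  · rintro ⟨m, rfl, rfl⟩
    rw [key, add_neg_cancel, ofAdd_zero, map_one]

theorem exists_extension_equiv {n : ℕ} [NeZero n] {a : Fin n → ℕ} (ha : ∀ i, a i ≠ 0) :
    ∃ (kappa : Gam a ≃* LZero (dual a)) (Phi : GamHat a ≃* Multiplicative (LTilde (dual a))),
      (∀ k : ℤ, Phi (shiftHat a (Multiplicative.ofAdd k)) =
        Multiplicative.ofAdd (shiftL (dual a) k)) ∧
      (∀ F : GamHat a, projL (dual a) (Multiplicative.toAdd (Phi F)) =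
        Additive.ofMul (kappa (projHat a F))) ∧
      Phi (gradedGenerator ha) = Multiplicative.ofAdd (tau (dual a)) := by
  have hb : ∀ i, dual a i ≠ 0 := fun i => ha _
  -- Both groups are quotients of ℤ with kernel d(a)ℤ; φ_a is matched with the image of τ, as the
  -- commuting square requires.
  obtain ⟨kappa, hkappa⟩ := exists_mulEquiv_of_ker_eq (zpowersHom _ (generator ha))
    (zpowersHom _ (tauChar (dual a)))
    (fun g => (exists_generator_zpow ha g).imp' Multiplicative.ofAdd fun _ h => h)
    (fun c => (exists_tauChar_zpow hb c).imp' Multiplicative.ofAdd fun _ h => h)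
    (fun i => by
      have h := tauChar_zpow_eq_one_iff hb i.toAdd
      rw [dInv_dual] at h
      exact (generator_zpow_eq_one_iff ha i.toAdd).trans h.symm)
  obtain ⟨Phi, hPhi⟩ := exists_mulEquiv_of_ker_eq (presHat ha) (presTilde (dual a))
    (presHat_surjective ha) (presTilde_surjective _)
    (fun x => (presHat_eq_one_iff ha x.toAdd.1 x.toAdd.2).trans
      (tau_add_T_eq_zero_iff a x.toAdd.1 x.toAdd.2).symm)
  refine ⟨kappa, Phi, fun k => ?_, fun F => ?_, ?_⟩
  · have h := hPhi (Multiplicative.ofAdd (0, k))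
    rw [presHat_apply, presTilde_apply, zpow_zero, one_mul, zero_smul, zero_add] at h
    exact h
  · obtain ⟨x, rfl⟩ := presHat_surjective ha F
    have h1 : projHat a (presHat ha x) = generator ha ^ x.toAdd.1 :=
      projHat_presHat ha x.toAdd.1 x.toAdd.2
    have h2 : kappa (generator ha ^ x.toAdd.1) = tauChar (dual a) ^ x.toAdd.1 :=
      hkappa (Multiplicative.ofAdd x.toAdd.1)
    rw [hPhi, h1, h2]
    exact projL_tau_add_T (dual a) x.toAdd.1 x.toAdd.2
  · have h := hPhi (Multiplicative.ofAdd (1, 0))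
    rw [presHat_apply, presTilde_apply, zpow_one, ofAdd_zero, map_one, mul_one, one_smul,
      zero_smul, add_zero] at h
    exact h

end ChainGrading

end

theorem mainTheorem7 (n : ℕ) [NeZero n] (a : Fin n → ℕ) (ha : ∀ i, 1 < a i) :
    -- `0 → ℤ → Γ̂_a^0 → Γ_a^0 → 0` is exact
    (Function.Injective (shiftHat a) ∧ (shiftHat a).range = (projHat a).ker ∧
      Function.Surjective (projHat a)) ∧
    -- `0 → ℤ → L̃_{a^∨} → L_{a^∨}^0 → 0` is exact
    (Function.Injective (shiftL (dual a)) ∧ (shiftL (dual a)).range = (projL (dual a)).ker ∧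
      Function.Surjective (projL (dual a))) ∧
    -- `L̃_{a^∨}` is generated by `τ` and `T` with a single relation
    ((∀ l : LTilde (dual a), ∃ i j : ℤ, l = i • tau (dual a) + j • gen (dual a) Gen.T) ∧
      ∀ i j : ℤ, i • tau (dual a) + j • gen (dual a) Gen.T = 0 ↔
        ∃ m : ℤ, i = m * dInv a ∧ j = -(m * ((-1) ^ n * (2 * (dInv a - milnor (dual a)))))) ∧
    -- `Γ_a^0` is generated by its unique element `phi` with first entry `e^{2 π i / d(a)}`
    ∃ phi : Gam a,
      (∀ g : Gam a, (((g : Fin n → ℂˣ) 0 : ℂˣ) : ℂ) =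
        Complex.exp (2 * Real.pi * Complex.I / (dInv a : ℂ)) ↔ g = phi) ∧
      (∀ g : Gam a, g ∈ Subgroup.zpowers phi) ∧
      -- there is exactly one graded lift of the time `1` map of the flow, it lifts `phi`, and some
      -- power of it is a shift
      ∃ phiT : GamHat a, (∀ F : GamHat a, IsFlowLift a F ↔ F = phiT) ∧
        projHat a phiT = phi ∧
        phiT ^ dInv a =
          shiftHat a (Multiplicative.ofAdd ((-1) ^ n * (2 * (dInv a - milnor (dual a))))) ∧
        -- isomorphism of extensions
        ∃ (kappa : Gam a ≃* LZero (dual a)) (Phi : GamHat a ≃* Multiplicative (LTilde (dual a))),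
          (∀ k : ℤ, Phi (shiftHat a (Multiplicative.ofAdd k)) =
            Multiplicative.ofAdd (shiftL (dual a) k)) ∧
          (∀ F : GamHat a, projL (dual a) (Multiplicative.toAdd (Phi F)) =
            Additive.ofMul (kappa (projHat a F))) ∧
          Phi phiT = Multiplicative.ofAdd (tau (dual a)) := by
  have ha' : ∀ i, a i ≠ 0 := fun i => (zero_lt_one.trans (ha i)).ne'
  refine ⟨exact_GamHat a ha', exact_LTilde a ha',
    ⟨exists_tau_add_T (dual a), tau_add_T_eq_zero_iff a⟩, generator ha', fun g => ?_, fun g => ?_,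
    gradedGenerator ha', isFlowLift_iff ha', projHat_gradedGenerator ha', gradedGenerator_pow ha',
    exists_extension_equiv ha'⟩
  · rw [← generator_apply_zero ha']
    exact ⟨fun h => Gam_ext (Units.ext h), fun h => by rw [h]⟩
  · exact exists_generator_zpow ha' g
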